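/- **Setting.** Let $f_1(x_1\mid\theta_1)$, $\theta_1\in\Theta_1\subseteq\mathbb R^{d_1}$, and $f_2(x_2\mid\theta_1,\theta_2)$, $\theta_2\in\Theta_2\subseteq\mathbb R^{d_2}$, be two families of probability densities, and put $\ell_1=\log f_1$, $\ell_2=\log f_2$ (with $\log 0=-\infty$). The pairs $(x_{1,j},x_{2,j})$, $j=1,2,\dots$, are i.i.d. with law $P^*$, whose marginals are $P_1^*,P_2^*$; $x_{1,j}$ and $x_{2,j}$ may be dependent, and neither module need be well specified. The two-stage MLE is $$\hat\theta_1=\arg\max_{\theta_1\in\Theta_1}\sum_{j=1}^n\ell_1(x_{1,j},\theta_1),\qquad \hat\theta_2=\arg\max_{\theta_2\in\Theta_2}\sum_{j=1}^n\ell_2(x_{2,j},\hat\theta_1,\theta_2)$$ (any random vectors $\hat\theta_1,\hat\theta_2$ that satisfy this with probability tending to one; the maximizers need not be unique). The pseudo-true parameters are the unique maximizers $$\theta_1^*=\arg\max_{\theta_1\in\Theta_1}E\,\ell_1(X_1,\theta_1),\qquad \theta_2^*=\arg\max_{\theta_2\in\Theta_2}E\,\ell_2(X_2,\theta_1^*,\theta_2).$$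 **Regularity conditions.** 1. $\ell_1,\ell_2$ are measurable in the data and bounded from above, and $E|\ell_1(X_1,\theta_1)|<\infty$, $E|\ell_2(X_2,\theta_1,\theta_2)|<\infty$ for all $\theta_1\in\Theta_1,\theta_2\in\Theta_2$. 2. The maximizers $\theta_1^*,\theta_2^*$ above exist and are unique, and for every $\theta_1$ in some open ball around $\theta_1^*$ contained in $\Theta_1$ the function $\theta_2\mapsto E\,\ell_2(X_2,\theta_1,\theta_2)$ has a unique maximizer over $\Theta_2$. For every $\delta>0$ there is $\epsilon>0$ with $$P\Big[\sup_{\theta_1\in\Theta_1,\ \|\theta_1-\theta_1^*\|\ge\delta}\tfrac1n\sum_{j=1}^n\{\ell_1(x_{1,j},\theta_1)-\ell_1(x_{1,j},\theta_1^*)\}\le-\epsilon\Big]\to1,$$ and for every $\delta>0$ there are $\epsilon,\rho>0$ with $$P\Big[\sup_{\substack{\theta_1\in\Theta_1,\ \|\theta_1-\theta_1^*\|<\rho\\ \theta_2\in\Theta_2,\ \|\theta_2-\theta_2^*\|\ge\delta}}\tfrac1n\sum_{j=1}^n\{\ell_2(x_{2,j},\theta_1,\theta_2)-\ell_2(x_{2,j},\theta_1^*,\theta_2^*)\}\le-\epsilon\Big]\to1.$$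 3. There are open balls $B_1\subseteq\Theta_1$ around $\theta_1^*$ and $B_2\subseteq\Theta_2$ around $\theta_2^*$ such that, almost surely, $\ell_1(x_1,\cdot)$ is finite and three times continuously differentiable on $B_1$ and $\ell_2(x_2,\cdot,\cdot)$ is finite and three times continuously differentiable on $B_1\times B_2$. There are measurable functions $G_1,\dots,G_6$ such that, almost surely, all partial derivatives of orders 1, 2, 3 of $\ell_1$ on $B_1$ are bounded in absolute value by $G_1(x_1),G_2(x_1),G_3(x_1)$, and those of $\ell_2$ with respect to $(\theta_1,\theta_2)$ on $B_1\times B_2$ by $G_4(x_2),G_5(x_2),G_6(x_2)$, where $E\,G_1^4,E\,G_2^4,E\,G_4^4,E\,G_5^4<\infty$ and $G_3,G_6$ are integrable. 4. The matrices $I_1(\theta_1)=E\big[\tfrac{\partial\ell_1}{\partial\theta_1}(\tfrac{\partial\ell_1}{\partial\theta_1})^T\big]$ and $J_1(\theta_1)=-E\big[\tfrac{\partial^2\ell_1}{\partial\theta_1\partial\theta_1^T}\big]$ for $\theta_1\in B_1$, and $I_2(\theta_1,\theta_2)=E\big[\tfrac{\partial\ell_2}{\partial\theta_2}(\tfrac{\partial\ell_2}{\partial\theta_2})^T\big]$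 and $J_2(\theta_1,\theta_2)=-E\big[\tfrac{\partial^2\ell_2}{\partial\theta_2\partial\theta_2^T}\big]$ for $(\theta_1,\theta_2)\in B_1\times B_2$, are positive definite. Let $I_1^*,J_1^*,I_2^*,J_2^*$ be the values of these matrices at $(\theta_1^*,\theta_2^*)$ and let, with all derivatives taken at $(\theta_1^*,\theta_2^*)$, $$R_I^*=E\Big[\frac{\partial\ell_1(X_1,\theta_1^*)}{\partial\theta_1}\Big(\frac{\partial\ell_2(X_2,\theta_1^*,\theta_2^*)}{\partial\theta_2}\Big)^T\Big],\qquad R_J^*=-E\Big[\frac{\partial^2\ell_2(X_2,\theta_1^*,\theta_2^*)}{\partial\theta_1\partial\theta_2^T}\Big].$$ **Proposition.** Put $S_1=J_1^{*-1}I_1^*J_1^{*-1}$, $S_2=R_I^{*T}J_1^{*-1}R_J^*+R_J^{*T}J_1^{*-1}R_I^*$, $S_3=J_1^{*-1}R_I^*J_2^{*-1}-S_1R_J^*J_2^{*-1}$ and $$\tilde\Sigma=\begin{pmatrix}S_1&S_3\\S_3^T&J_2^{*-1}\big(I_2^*+R_J^{*T}S_1R_J^*-S_2\big)J_2^{*-1}\end{pmatrix}.$$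 Then $\tilde\Sigma$ is positive semidefinite, and as $n\to\infty$ $$\sqrt n\,(\hat\theta_1-\theta_1^*,\ \hat\theta_2-\theta_2^*)\ \longrightarrow\ N(0,\tilde\Sigma)\quad\text{in distribution}.$$ -/

import Mathlib

open MeasureTheory ProbabilityTheory Filter Topology
open scoped NNReal ENNReal

noncomputable section

namespace TwoStage

/-! ### Partial derivatives and concatenation of parameters -/

/-- The partial derivative `∂F/∂θ_i` of a real function on `ℝ^ι`. -/
def partialDeriv {ι : Type*} [Fintype ι] [DecidableEq ι] (i : ι)
    (F : EuclideanSpace ℝ ι → ℝ) (θ : EuclideanSpace ℝ ι) : ℝ :=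
  fderiv ℝ F θ (EuclideanSpace.single i 1)

/-- The vector `(θ₁, θ₂)` in `ℝ^(d₁ + d₂)`. -/
def join {d₁ d₂ : ℕ} (θ₁ : EuclideanSpace ℝ (Fin d₁)) (θ₂ : EuclideanSpace ℝ (Fin d₂)) :
    EuclideanSpace ℝ (Fin d₁ ⊕ Fin d₂) :=
  WithLp.toLp 2 (Sum.elim (fun i => θ₁ i) (fun i => θ₂ i))

/-- The first block `θ₁` of `θ = (θ₁, θ₂)`. -/
def fstPart {d₁ d₂ : ℕ} (θ : EuclideanSpace ℝ (Fin d₁ ⊕ Fin d₂)) : EuclideanSpace ℝ (Fin d₁) :=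
  WithLp.toLp 2 (fun i => θ (Sum.inl i))

/-- The second block `θ₂` of `θ = (θ₁, θ₂)`. -/
def sndPart {d₁ d₂ : ℕ} (θ : EuclideanSpace ℝ (Fin d₁ ⊕ Fin d₂)) : EuclideanSpace ℝ (Fin d₂) :=
  WithLp.toLp 2 (fun i => θ (Sum.inr i))

/-- `t` is the unique maximizer of `g` over `S`. -/
def IsUniqueArgmax {E : Type*} (S : Set E) (g : E → ℝ) (t : E) : Prop :=
  t ∈ S ∧ ∀ s ∈ S, s ≠ t → g s < g t

/-! ### The two-module model -/

/-- A model with two modules: a family of densities `f₁(· | θ₁)`, `θ₁ ∈ Θ₁ ⊆ ℝ^d₁`, and a family of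
densities `f₂(· | θ₁, θ₂)`, `θ₁ ∈ Θ₁`, `θ₂ ∈ Θ₂ ⊆ ℝ^d₂`, with respect to reference measures
`ν₁` and `ν₂`. -/
structure CutModel (𝓧₁ 𝓧₂ : Type*) [MeasurableSpace 𝓧₁] [MeasurableSpace 𝓧₂] (d₁ d₂ : ℕ) where
  /-- parameter set of the first module -/
  Θ₁ : Set (EuclideanSpace ℝ (Fin d₁))
  /-- parameter set of the second module -/
  Θ₂ : Set (EuclideanSpace ℝ (Fin d₂))
  /-- reference measure of the first module -/
  ν₁ : Measure 𝓧₁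
  /-- reference measure of the second module -/
  ν₂ : Measure 𝓧₂
  /-- likelihood of the first module -/
  f₁ : 𝓧₁ → EuclideanSpace ℝ (Fin d₁) → ℝ≥0
  /-- likelihood of the second module -/
  f₂ : 𝓧₂ → EuclideanSpace ℝ (Fin d₁) → EuclideanSpace ℝ (Fin d₂) → ℝ≥0
  measurable_f₁ : ∀ θ₁ ∈ Θ₁, Measurable fun x => f₁ x θ₁
  measurable_f₂ : ∀ θ₁ ∈ Θ₁, ∀ θ₂ ∈ Θ₂, Measurable fun x => f₂ x θ₁ θ₂
  lintegral_f₁ : ∀ θ₁ ∈ Θ₁, ∫⁻ x, (f₁ x θ₁ : ℝ≥0∞) ∂ν₁ = 1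
  lintegral_f₂ : ∀ θ₁ ∈ Θ₁, ∀ θ₂ ∈ Θ₂, ∫⁻ x, (f₂ x θ₁ θ₂ : ℝ≥0∞) ∂ν₂ = 1

namespace CutModel

variable {𝓧₁ 𝓧₂ : Type*} [MeasurableSpace 𝓧₁] [MeasurableSpace 𝓧₂] {d₁ d₂ : ℕ}
  (M : CutModel 𝓧₁ 𝓧₂ d₁ d₂)

/-- `log f₁(x | θ₁)` with the convention `log 0 = -∞`. -/
def elogLik₁ (x : 𝓧₁) (θ₁ : EuclideanSpace ℝ (Fin d₁)) : EReal :=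
  ENNReal.log (M.f₁ x θ₁)

/-- `log f₂(x | θ₁, θ₂)` with the convention `log 0 = -∞`. -/
def elogLik₂ (x : 𝓧₂) (θ₁ : EuclideanSpace ℝ (Fin d₁)) (θ₂ : EuclideanSpace ℝ (Fin d₂)) : EReal :=
  ENNReal.log (M.f₂ x θ₁ θ₂)

/-- `ℓ₁(x, θ₁) = log f₁(x | θ₁)` as a real number; used only where `f₁(x | θ₁) > 0`. -/
def logLik₁ (x : 𝓧₁) (θ₁ : EuclideanSpace ℝ (Fin d₁)) : ℝ :=
  Real.log (M.f₁ x θ₁)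

/-- `ℓ₂(x, θ₁, θ₂) = log f₂(x | θ₁, θ₂)` as a real number; used only where
`f₂(x | θ₁, θ₂) > 0`. -/
def logLik₂ (x : 𝓧₂) (θ₁ : EuclideanSpace ℝ (Fin d₁)) (θ₂ : EuclideanSpace ℝ (Fin d₂)) : ℝ :=
  Real.log (M.f₂ x θ₁ θ₂)

/-- `ℓ₂(x, ·)` as a function of the concatenated parameter `θ = (θ₁, θ₂)`. -/
def jointLogLik₂ (x : 𝓧₂) (θ : EuclideanSpace ℝ (Fin d₁ ⊕ Fin d₂)) : ℝ :=
  M.logLik₂ x (fstPart θ) (sndPart θ)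

/-! ### The two-stage maximum likelihood estimator -/

/-- `(t₁, t₂)` is a two-stage maximum likelihood estimate based on the first `n` members of the
sample `x`: `t₁` maximizes `∑ log f₁(x_{1,j} | ·)` over `Θ₁`, and `t₂` maximizes
`∑ log f₂(x_{2,j} | t₁, ·)` over `Θ₂`. -/
def IsTwoStageMLE (n : ℕ) (x : ℕ → 𝓧₁ × 𝓧₂)
    (t₁ : EuclideanSpace ℝ (Fin d₁)) (t₂ : EuclideanSpace ℝ (Fin d₂)) : Prop :=
  (t₁ ∈ M.Θ₁ ∧ ∀ θ₁ ∈ M.Θ₁,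
    ∑ j ∈ Finset.range n, M.elogLik₁ (x j).1 θ₁ ≤ ∑ j ∈ Finset.range n, M.elogLik₁ (x j).1 t₁) ∧
  (t₂ ∈ M.Θ₂ ∧ ∀ θ₂ ∈ M.Θ₂,
    ∑ j ∈ Finset.range n, M.elogLik₂ (x j).2 t₁ θ₂ ≤
      ∑ j ∈ Finset.range n, M.elogLik₂ (x j).2 t₁ t₂)

/-! ### Information matrices -/

/-- `I₁(θ₁) = E[∂ℓ₁/∂θ₁ (∂ℓ₁/∂θ₁)ᵀ]`. -/
def I₁ (P₁ : Measure 𝓧₁) (θ₁ : EuclideanSpace ℝ (Fin d₁)) : Matrix (Fin d₁) (Fin d₁) ℝ :=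
  Matrix.of fun j k => ∫ x, partialDeriv j (M.logLik₁ x) θ₁ * partialDeriv k (M.logLik₁ x) θ₁ ∂P₁

/-- `J₁(θ₁) = -E[∂²ℓ₁/∂θ₁∂θ₁ᵀ]`. -/
def J₁ (P₁ : Measure 𝓧₁) (θ₁ : EuclideanSpace ℝ (Fin d₁)) : Matrix (Fin d₁) (Fin d₁) ℝ :=
  Matrix.of fun j k => -∫ x, partialDeriv j (partialDeriv k (M.logLik₁ x)) θ₁ ∂P₁

/-- `I₂(θ₁, θ₂) = E[∂ℓ₂/∂θ₂ (∂ℓ₂/∂θ₂)ᵀ]`. -/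
def I₂ (P₂ : Measure 𝓧₂) (θ₁ : EuclideanSpace ℝ (Fin d₁)) (θ₂ : EuclideanSpace ℝ (Fin d₂)) :
    Matrix (Fin d₂) (Fin d₂) ℝ :=
  Matrix.of fun j k =>
    ∫ x, partialDeriv (Sum.inr j) (M.jointLogLik₂ x) (join θ₁ θ₂) *
      partialDeriv (Sum.inr k) (M.jointLogLik₂ x) (join θ₁ θ₂) ∂P₂

/-- `J₂(θ₁, θ₂) = -E[∂²ℓ₂/∂θ₂∂θ₂ᵀ]`. -/
def J₂ (P₂ : Measure 𝓧₂) (θ₁ : EuclideanSpace ℝ (Fin d₁)) (θ₂ : EuclideanSpace ℝ (Fin d₂)) :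
    Matrix (Fin d₂) (Fin d₂) ℝ :=
  Matrix.of fun j k =>
    -∫ x, partialDeriv (Sum.inr j) (partialDeriv (Sum.inr k) (M.jointLogLik₂ x)) (join θ₁ θ₂) ∂P₂

/-- The cross-score matrix `R_I = E[∂ℓ₁/∂θ₁ (∂ℓ₂/∂θ₂)ᵀ]`, of size `d₁ × d₂`. -/
def RI (Pstar : Measure (𝓧₁ × 𝓧₂)) (θ₁ : EuclideanSpace ℝ (Fin d₁))
    (θ₂ : EuclideanSpace ℝ (Fin d₂)) : Matrix (Fin d₁) (Fin d₂) ℝ :=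
  Matrix.of fun j k =>
    ∫ x, partialDeriv j (M.logLik₁ x.1) θ₁ *
      partialDeriv (Sum.inr k) (M.jointLogLik₂ x.2) (join θ₁ θ₂) ∂Pstar

/-- `R_J = -E[∂²ℓ₂/∂θ₁∂θ₂ᵀ]`, of size `d₁ × d₂`. -/
def RJ (P₂ : Measure 𝓧₂) (θ₁ : EuclideanSpace ℝ (Fin d₁)) (θ₂ : EuclideanSpace ℝ (Fin d₂)) :
    Matrix (Fin d₁) (Fin d₂) ℝ :=
  Matrix.of fun j k =>
    -∫ x, partialDeriv (Sum.inl j) (partialDeriv (Sum.inr k) (M.jointLogLik₂ x)) (join θ₁ θ₂) ∂P₂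

/-! ### Regularity conditions

Throughout, `P₁` and `P₂` are the laws of a single `x_{1,j}` and of a single `x_{2,j}`, and
`(t₁, t₂)` is the pseudo-true parameter. -/

/-- The log likelihoods are bounded from above and integrable; in particular they are almost surely
finite. -/
structure LogLikIntegrable (P₁ : Measure 𝓧₁) (P₂ : Measure 𝓧₂) : Prop where
  bddAbove₁ : ∃ C : ℝ, ∀ x, ∀ θ₁ ∈ M.Θ₁, M.elogLik₁ x θ₁ ≤ (C : EReal)
  bddAbove₂ : ∃ C : ℝ, ∀ x, ∀ θ₁ ∈ M.Θ₁, ∀ θ₂ ∈ M.Θ₂, M.elogLik₂ x θ₁ θ₂ ≤ (C : EReal)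
  pos₁ : ∀ θ₁ ∈ M.Θ₁, ∀ᵐ x ∂P₁, 0 < M.f₁ x θ₁
  pos₂ : ∀ θ₁ ∈ M.Θ₁, ∀ θ₂ ∈ M.Θ₂, ∀ᵐ x ∂P₂, 0 < M.f₂ x θ₁ θ₂
  integrable₁ : ∀ θ₁ ∈ M.Θ₁, Integrable (fun x => M.logLik₁ x θ₁) P₁
  integrable₂ : ∀ θ₁ ∈ M.Θ₁, ∀ θ₂ ∈ M.Θ₂, Integrable (fun x => M.logLik₂ x θ₁ θ₂) P₂

/-- `(t₁, t₂)` is the pseudo-true parameter: `t₁` is the unique maximizer of `E ℓ₁(X₁, ·)` over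
`Θ₁`, and `t₂` is the unique maximizer of `E ℓ₂(X₂, t₁, ·)` over `Θ₂`. -/
structure IsPseudoTrue (P₁ : Measure 𝓧₁) (P₂ : Measure 𝓧₂)
    (t₁ : EuclideanSpace ℝ (Fin d₁)) (t₂ : EuclideanSpace ℝ (Fin d₂)) : Prop where
  argmax₁ : IsUniqueArgmax M.Θ₁ (fun θ₁ => ∫ x, M.logLik₁ x θ₁ ∂P₁) t₁
  argmax₂ : IsUniqueArgmax M.Θ₂ (fun θ₂ => ∫ x, M.logLik₂ x t₁ θ₂ ∂P₂) t₂

/-- For every `θ₁` in some ball around `t₁` contained in `Θ₁`, the function `E ℓ₂(X₂, θ₁, ·)` has a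
unique maximizer over `Θ₂`. -/
def LocalArgmax (P₂ : Measure 𝓧₂) (t₁ : EuclideanSpace ℝ (Fin d₁)) : Prop :=
  ∃ r > 0, Metric.ball t₁ r ⊆ M.Θ₁ ∧ ∀ θ₁ ∈ Metric.ball t₁ r,
    ∃ s, IsUniqueArgmax M.Θ₂ (fun θ₂ => ∫ x, M.logLik₂ x θ₁ θ₂ ∂P₂) s

/-- Separation in the first module: for each `δ > 0` there is `ε > 0` such that, with probability
tending to one, the normalized log likelihood ratio against `t₁` is at most `-ε` uniformly
over the `θ₁ ∈ Θ₁` at distance at least `δ` from `t₁`. -/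
def Separated₁ {Ω : Type*} [MeasurableSpace Ω] (P : Measure Ω) (X : ℕ → Ω → 𝓧₁ × 𝓧₂)
    (t₁ : EuclideanSpace ℝ (Fin d₁)) : Prop :=
  ∀ δ : ℝ, 0 < δ → ∃ ε : ℝ, 0 < ε ∧
    Tendsto (fun n : ℕ => P {ω |
      ⨆ θ₁ ∈ {θ₁ | θ₁ ∈ M.Θ₁ ∧ δ ≤ ‖θ₁ - t₁‖},
        (∑ j ∈ Finset.range n, (M.elogLik₁ (X j ω).1 θ₁ - M.elogLik₁ (X j ω).1 t₁)) / (n : EReal)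
      ≤ ((-ε : ℝ) : EReal)}) atTop (𝓝 1)

/-- Separation in the second module: for each `δ > 0` there are `ε, ρ > 0` such that, with
probability tending to one, the normalized log likelihood ratio of the second module against
`(t₁, t₂)` is at most `-ε` uniformly over the `(θ₁, θ₂) ∈ Θ₁ × Θ₂` with `‖θ₁ - t₁‖ < ρ` and
`‖θ₂ - t₂‖ ≥ δ`. -/
def Separated₂ {Ω : Type*} [MeasurableSpace Ω] (P : Measure Ω) (X : ℕ → Ω → 𝓧₁ × 𝓧₂)
    (t₁ : EuclideanSpace ℝ (Fin d₁)) (t₂ : EuclideanSpace ℝ (Fin d₂)) : Prop :=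
  ∀ δ : ℝ, 0 < δ → ∃ ε : ℝ, 0 < ε ∧ ∃ ρ : ℝ, 0 < ρ ∧
    Tendsto (fun n : ℕ => P {ω |
      ⨆ θ₁ ∈ {θ₁ | θ₁ ∈ M.Θ₁ ∧ ‖θ₁ - t₁‖ < ρ}, ⨆ θ₂ ∈ {θ₂ | θ₂ ∈ M.Θ₂ ∧ δ ≤ ‖θ₂ - t₂‖},
        (∑ j ∈ Finset.range n,
          (M.elogLik₂ (X j ω).2 θ₁ θ₂ - M.elogLik₂ (X j ω).2 t₁ t₂)) / (n : EReal)
      ≤ ((-ε : ℝ) : EReal)}) atTop (𝓝 1)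

/-- Smoothness and moment conditions on `B₁` and `B₁ × B₂`. -/
structure Smooth (P₁ : Measure 𝓧₁) (P₂ : Measure 𝓧₂)
    (B₁ : Set (EuclideanSpace ℝ (Fin d₁))) (B₂ : Set (EuclideanSpace ℝ (Fin d₂))) : Prop where
  contDiff₁ : ∀ᵐ x ∂P₁, (∀ θ₁ ∈ B₁, 0 < M.f₁ x θ₁) ∧ ContDiffOn ℝ 3 (M.logLik₁ x) B₁
  contDiff₂ : ∀ᵐ x ∂P₂, (∀ θ₁ ∈ B₁, ∀ θ₂ ∈ B₂, 0 < M.f₂ x θ₁ θ₂) ∧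
    ContDiffOn ℝ 3 (M.jointLogLik₂ x) {θ | fstPart θ ∈ B₁ ∧ sndPart θ ∈ B₂}
  bound₁ : ∃ G : 𝓧₁ → ℝ, Measurable G ∧ Integrable (fun x => G x ^ 4) P₁ ∧
    ∀ᵐ x ∂P₁, ∀ θ₁ ∈ B₁, ∀ j, |partialDeriv j (M.logLik₁ x) θ₁| ≤ G x
  bound₂ : ∃ G : 𝓧₁ → ℝ, Measurable G ∧ Integrable (fun x => G x ^ 4) P₁ ∧
    ∀ᵐ x ∂P₁, ∀ θ₁ ∈ B₁, ∀ j k, |partialDeriv j (partialDeriv k (M.logLik₁ x)) θ₁| ≤ G x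
  bound₃ : ∃ G : 𝓧₁ → ℝ, Measurable G ∧ Integrable G P₁ ∧
    ∀ᵐ x ∂P₁, ∀ θ₁ ∈ B₁, ∀ j k l,
      |partialDeriv j (partialDeriv k (partialDeriv l (M.logLik₁ x))) θ₁| ≤ G x
  bound₄ : ∃ G : 𝓧₂ → ℝ, Measurable G ∧ Integrable (fun x => G x ^ 4) P₂ ∧
    ∀ᵐ x ∂P₂, ∀ θ₁ ∈ B₁, ∀ θ₂ ∈ B₂, ∀ j,
      |partialDeriv j (M.jointLogLik₂ x) (join θ₁ θ₂)| ≤ G x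
  bound₅ : ∃ G : 𝓧₂ → ℝ, Measurable G ∧ Integrable (fun x => G x ^ 4) P₂ ∧
    ∀ᵐ x ∂P₂, ∀ θ₁ ∈ B₁, ∀ θ₂ ∈ B₂, ∀ j k,
      |partialDeriv j (partialDeriv k (M.jointLogLik₂ x)) (join θ₁ θ₂)| ≤ G x
  bound₆ : ∃ G : 𝓧₂ → ℝ, Measurable G ∧ Integrable G P₂ ∧
    ∀ᵐ x ∂P₂, ∀ θ₁ ∈ B₁, ∀ θ₂ ∈ B₂, ∀ j k l,
      |partialDeriv j (partialDeriv k (partialDeriv l (M.jointLogLik₂ x))) (join θ₁ θ₂)| ≤ G x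

/-- Positive definiteness of the information matrices on `B₁` and `B₁ × B₂`. -/
structure InfoPosDef (P₁ : Measure 𝓧₁) (P₂ : Measure 𝓧₂)
    (B₁ : Set (EuclideanSpace ℝ (Fin d₁))) (B₂ : Set (EuclideanSpace ℝ (Fin d₂))) : Prop where
  posDef_I₁ : ∀ θ₁ ∈ B₁, (M.I₁ P₁ θ₁).PosDef
  posDef_J₁ : ∀ θ₁ ∈ B₁, (M.J₁ P₁ θ₁).PosDef
  posDef_I₂ : ∀ θ₁ ∈ B₁, ∀ θ₂ ∈ B₂, (M.I₂ P₂ θ₁ θ₂).PosDef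
  posDef_J₂ : ∀ θ₁ ∈ B₁, ∀ θ₂ ∈ B₂, (M.J₂ P₂ θ₁ θ₂).PosDef

/-- There are balls `B₁ ⊆ Θ₁` around `t₁` and `B₂ ⊆ Θ₂` around `t₂` on which the smoothness, moment
and positive definiteness conditions hold. -/
def LocallyRegular (P₁ : Measure 𝓧₁) (P₂ : Measure 𝓧₂)
    (t₁ : EuclideanSpace ℝ (Fin d₁)) (t₂ : EuclideanSpace ℝ (Fin d₂)) : Prop :=
  ∃ r₁ > 0, ∃ r₂ > 0, Metric.ball t₁ r₁ ⊆ M.Θ₁ ∧ Metric.ball t₂ r₂ ⊆ M.Θ₂ ∧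
    M.Smooth P₁ P₂ (Metric.ball t₁ r₁) (Metric.ball t₂ r₂) ∧
    M.InfoPosDef P₁ P₂ (Metric.ball t₁ r₁) (Metric.ball t₂ r₂)

end CutModel

/-! ### The limiting covariance -/

section Covariance

variable {d₁ d₂ : ℕ}

/-- `S₁ = J₁⁻¹ I₁ J₁⁻¹`. -/
def S₁ (I₁ J₁ : Matrix (Fin d₁) (Fin d₁) ℝ) : Matrix (Fin d₁) (Fin d₁) ℝ :=
  J₁⁻¹ * I₁ * J₁⁻¹

/-- `S₂ = R_Iᵀ J₁⁻¹ R_J + R_Jᵀ J₁⁻¹ R_I`. -/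
def S₂ (J₁ : Matrix (Fin d₁) (Fin d₁) ℝ) (RI RJ : Matrix (Fin d₁) (Fin d₂) ℝ) :
    Matrix (Fin d₂) (Fin d₂) ℝ :=
  RI.transpose * J₁⁻¹ * RJ + RJ.transpose * J₁⁻¹ * RI

/-- `S₃ = J₁⁻¹ R_I J₂⁻¹ - S₁ R_J J₂⁻¹`. -/
def S₃ (I₁ J₁ : Matrix (Fin d₁) (Fin d₁) ℝ) (J₂ : Matrix (Fin d₂) (Fin d₂) ℝ)
    (RI RJ : Matrix (Fin d₁) (Fin d₂) ℝ) : Matrix (Fin d₁) (Fin d₂) ℝ :=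
  J₁⁻¹ * RI * J₂⁻¹ - S₁ I₁ J₁ * RJ * J₂⁻¹

/-- The block matrix with blocks `S₁`, `S₃`, `S₃ᵀ` and
`J₂⁻¹ (I₂ + R_Jᵀ S₁ R_J - S₂) J₂⁻¹`. -/
def asympCov (I₁ J₁ : Matrix (Fin d₁) (Fin d₁) ℝ) (I₂ J₂ : Matrix (Fin d₂) (Fin d₂) ℝ)
    (RI RJ : Matrix (Fin d₁) (Fin d₂) ℝ) : Matrix (Fin d₁ ⊕ Fin d₂) (Fin d₁ ⊕ Fin d₂) ℝ :=
  Matrix.fromBlocks (S₁ I₁ J₁) (S₃ I₁ J₁ J₂ RI RJ) (S₃ I₁ J₁ J₂ RI RJ).transpose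
    (J₂⁻¹ * (I₂ + RJ.transpose * S₁ I₁ J₁ * RJ - S₂ J₁ RI RJ) * J₂⁻¹)

end Covariance

end TwoStage

end

/-! The two-stage estimator is a Z-estimator for the joint parameter. Stack the scores ∂ℓ₁/∂θ₁ and
∂ℓ₂/∂θ₂ into one system of d₁ + d₂ equations. Once both estimators are consistent they lie, with
probability tending to one, in open balls inside the parameter sets, where maximality forces the
stacked empirical score to vanish (`sum_score₁`, `sum_score₂`).

At the pseudo-true parameter the stacked score is centred, by differentiating the population
criteria under the integral (`integral_partialDeriv_eq_zero`). Its expected Jacobian is the block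
matrix -(J₁, 0; R_Jᵀ, J₂), the zero block reflecting that ℓ₁ does not involve θ₂. Its second moment
matrix is (I₁, R_I; R_Iᵀ, I₂), whose off-diagonal blocks carry the dependence between the modules.
With B the inverse of that Jacobian, `tendstoInDistribution_zEstimator` compares √n(θ̂ - θ*) with
the normalized sum of -B times the score: Taylor expansion, the law of large numbers and consistency
make the difference negligible, and the multivariate central limit theorem gives the limit. The
limiting covariance B V Bᵀ is expanded blockwise in `bread_sandwich`; it is positive semidefinite
because it is itself a second moment matrix.

Consistency is Wald's argument based on the separation conditions. In the second stage the
competitor must share the first coordinate θ̂₁, so the loss from replacing θ₁* by θ̂₁ is controlled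
by a Lipschitz bound (`consistent₂`). The separation and maximization events need not be measurable,
which is why "probability tending to one" is expressed through the outer measure of the failure
sets. -/

namespace TwoStage

/-! ### Events whose probability tends to one -/

section WithHighProb

variable {Ω : Type*} [MeasurableSpace Ω] {P : Measure Ω}

/-- The events `E n` fail with (outer) probability tending to zero. -/
def WithHighProb (P : Measure Ω) (E : ℕ → Ω → Prop) : Prop :=
  Tendsto (fun n => P {ω | ¬ E n ω}) atTop (𝓝 0)

lemma WithHighProb.mono_ae {E F : ℕ → Ω → Prop} (hE : WithHighProb P E)
    (h : ∀ᶠ n in atTop, ∀ᵐ ω ∂P, E n ω → F n ω) : WithHighProb P F := by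
  refine tendsto_of_tendsto_of_tendsto_of_le_of_le' tendsto_const_nhds hE
    (Eventually.of_forall fun n => zero_le) ?_
  filter_upwards [h] with n hn
  refine measure_mono_ae ?_
  filter_upwards [hn] with ω hω h1 h2
  exact h1 (hω h2)

lemma WithHighProb.mono {E F : ℕ → Ω → Prop} (hE : WithHighProb P E)
    (h : ∀ n ω, E n ω → F n ω) : WithHighProb P F :=
  hE.mono_ae (.of_forall fun n => .of_forall (h n))

lemma WithHighProb.of_ae {E : ℕ → Ω → Prop} (h : ∀ᵐ ω ∂P, ∀ n, E n ω) : WithHighProb P E := by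
  have : ∀ n, P {ω | ¬ E n ω} = 0 := fun n => by
    rw [← ae_iff]; filter_upwards [h] with ω hω using hω n
  simp [WithHighProb, this]

lemma WithHighProb.and {E F : ℕ → Ω → Prop} (hE : WithHighProb P E) (hF : WithHighProb P F) :
    WithHighProb P (fun n ω => E n ω ∧ F n ω) := by
  have h := Tendsto.add hE hF
  rw [add_zero] at h
  refine tendsto_of_tendsto_of_tendsto_of_le_of_le tendsto_const_nhds h
    (fun n => zero_le) fun n => ?_
  refine (measure_mono ?_).trans (measure_union_le _ _)
  intro ω hω
  by_cases hE' : E n ω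
  · exact Or.inr fun hF' => hω ⟨hE', hF'⟩
  · exact Or.inl hE'

lemma WithHighProb.all {ι : Type*} [Finite ι] {E : ι → ℕ → Ω → Prop}
    (hE : ∀ i, WithHighProb P (E i)) : WithHighProb P (fun n ω => ∀ i, E i n ω) := by
  cases nonempty_fintype ι
  have h : Tendsto (fun n => ∑ i, P {ω | ¬ E i n ω}) atTop (𝓝 (∑ i : ι, 0)) :=
    tendsto_finsetSum _ fun i _ => hE i
  rw [Finset.sum_const_zero] at h
  refine tendsto_of_tendsto_of_tendsto_of_le_of_le tendsto_const_nhds h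
    (fun n => zero_le) fun n => ?_
  have : {ω | ¬ ∀ i, E i n ω} = ⋃ i ∈ Finset.univ, {ω | ¬ E i n ω} := by
    ext ω; simp
  rw [this]
  exact measure_biUnion_finset_le _ _

/-- If `1 - P A n → 0` (outer measure) and `A n` implies the null-measurable event `E n` outside
sets of vanishing probability, then `E n` holds with probability tending to one. -/
lemma WithHighProb.of_tendsto_one [IsProbabilityMeasure P] {A E : ℕ → Ω → Prop}
    {C : ℕ → Ω → Prop}
    (hA : Tendsto (fun n => P {ω | A n ω}) atTop (𝓝 1)) (hC : WithHighProb P C)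
    (hE : ∀ n, NullMeasurableSet {ω | E n ω} P)
    (h : ∀ n ω, A n ω → C n ω → E n ω) : WithHighProb P E := by
  have h1 : ∀ n, P {ω | ¬ E n ω} ≤ (1 - P {ω | A n ω}) + P {ω | ¬ C n ω} := by
    intro n
    have h2 : P {ω | A n ω} ≤ P {ω | E n ω} + P {ω | ¬ C n ω} := by
      refine (measure_mono fun ω hω => ?_).trans (measure_union_le _ _)
      by_cases hc : C n ω
      · exact Or.inl (h n ω hω hc)
      · exact Or.inr hc
    -- Complementation is available only for the null-measurable event. For `A` the outer measures
    -- of the set and of its complement may add up to more than one.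
    have h3 : P {ω | ¬ E n ω} = 1 - P {ω | E n ω} := prob_compl_eq_one_sub₀ (hE n)
    rw [h3]
    refine tsub_le_iff_right.2 ?_
    calc (1 : ℝ≥0∞) ≤ 1 - P {ω | A n ω} + P {ω | A n ω} := le_tsub_add
      _ ≤ 1 - P {ω | A n ω} + (P {ω | E n ω} + P {ω | ¬ C n ω}) := by gcongr
      _ = _ := by ring
  have h4 : Tendsto (fun n => (1 - P {ω | A n ω}) + P {ω | ¬ C n ω}) atTop (𝓝 (1 - 1 + 0)) :=
    (ENNReal.Tendsto.sub tendsto_const_nhds hA (by simp)).add hC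
  rw [tsub_self, add_zero] at h4
  exact tendsto_of_tendsto_of_tendsto_of_le_of_le tendsto_const_nhds h4 (fun n => zero_le) h1

lemma WithHighProb.of_ae_tendsto [IsFiniteMeasure P] {f : ℕ → Ω → ℝ} {c : ℝ}
    (hf : ∀ n, AEStronglyMeasurable (f n) P)
    (h : ∀ᵐ ω ∂P, Tendsto (fun n => f n ω) atTop (𝓝 c)) {ε : ℝ} (hε : 0 < ε) :
    WithHighProb P (fun n ω => |f n ω - c| < ε) := by
  have := tendstoInMeasure_iff_norm.1 (tendstoInMeasure_of_tendsto_ae hf h) ε hε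
  simpa [WithHighProb, not_lt] using this

end WithHighProb

/-! ### Limit theorems for i.i.d. samples -/

section Limit

variable {𝓧 Ω : Type*} [MeasurableSpace 𝓧] [MeasurableSpace Ω] {P : Measure Ω}
  {μ : Measure 𝓧} {X : ℕ → Ω → 𝓧}

lemma ae_forall_sample (hlaw : ∀ j, HasLaw (X j) μ P) {p : 𝓧 → Prop} (hp : ∀ᵐ x ∂μ, p x) :
    ∀ᵐ ω ∂P, ∀ j, p (X j ω) := by
  refine ae_all_iff.2 fun j => ?_
  refine ae_of_ae_map (hlaw j).aemeasurable ?_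
  rwa [(hlaw j).map_eq]

lemma identDistrib_comp {E : Type*} [MeasurableSpace E] (hlaw : ∀ j, HasLaw (X j) μ P)
    {φ : 𝓧 → E} (hφ : AEMeasurable φ μ) (j : ℕ) :
    IdentDistrib (fun ω => φ (X j ω)) (fun ω => φ (X 0 ω)) P P := by
  have h (i : ℕ) : AEMeasurable φ (P.map (X i)) := (hlaw i).map_eq ▸ hφ
  refine ⟨(h j).comp_aemeasurable (hlaw j).aemeasurable,
    (h 0).comp_aemeasurable (hlaw 0).aemeasurable, ?_⟩
  have (i : ℕ) : P.map (fun ω => φ (X i ω)) = μ.map φ := by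
    change P.map (φ ∘ X i) = _
    rw [← AEMeasurable.map_map_of_aemeasurable (h i) (hlaw i).aemeasurable, (hlaw i).map_eq]
  rw [this, this]

lemma iIndepFun_comp {E : Type*} [MeasurableSpace E] (hindep : iIndepFun X P)
    (hlaw : ∀ j, HasLaw (X j) μ P) {φ : 𝓧 → E} (hφ : AEMeasurable φ μ) :
    iIndepFun (fun j ω => φ (X j ω)) P :=
  hindep.comp₀ (fun _ => φ) (fun j => (hlaw j).aemeasurable)
    (fun j => (hlaw j).map_eq ▸ hφ)

lemma aemeasurable_sample {E : Type*} [MeasurableSpace E]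
    (hlaw : ∀ j, HasLaw (X j) μ P) {φ : 𝓧 → E} (hφ : AEMeasurable φ μ) (j : ℕ) :
    AEMeasurable (fun ω => φ (X j ω)) P :=
  (identDistrib_comp hlaw hφ j).aemeasurable_fst

lemma law_of_large_numbers [IsProbabilityMeasure P] (hindep : iIndepFun X P) (hlaw : ∀ j, HasLaw (X j) μ P)
    {φ : 𝓧 → ℝ} (hφ : Integrable φ μ) {ε : ℝ} (hε : 0 < ε) :
    WithHighProb P (fun n ω => |(∑ j ∈ Finset.range n, φ (X j ω)) / n - ∫ x, φ x ∂μ| < ε) := by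
  have hm := hφ.aestronglyMeasurable.aemeasurable
  have hint : Integrable (fun ω => φ (X 0 ω)) P :=
    ((hlaw 0).map_eq ▸ hφ : Integrable φ (P.map (X 0))).comp_aemeasurable (hlaw 0).aemeasurable
  refine WithHighProb.of_ae_tendsto (fun n => ?_) ?_ hε
  · refine AEMeasurable.aestronglyMeasurable ?_
    exact (Finset.aemeasurable_fun_sum _ fun j _ => aemeasurable_sample hlaw hm j).div_const _
  · have h := strong_law_ae_real (fun j ω => φ (X j ω)) hint
      (fun i j hij => (iIndepFun_comp hindep hlaw hm).indepFun hij) (identDistrib_comp hlaw hm)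
    have h2 : ∫ ω, φ (X 0 ω) ∂P = ∫ x, φ x ∂μ := (hlaw 0).integral_comp hφ.aestronglyMeasurable
    rwa [h2] at h

variable {ι : Type*} [Fintype ι]

/-- The second moment matrix of a random vector. -/
noncomputable def secondMoment (μ : Measure 𝓧) (φ : ι → 𝓧 → ℝ) : Matrix ι ι ℝ :=
  Matrix.of fun i k => ∫ x, φ i x * φ k x ∂μ

/-- Expanding the square identifies the quadratic form with the second moment of a scalar
combination. This serves both positive semidefiniteness and the variance in the Cramér–Wold
reduction. -/
lemma dotProduct_secondMoment {φ : ι → 𝓧 → ℝ} (hφ : ∀ i, MemLp (φ i) 2 μ) (v : ι → ℝ) :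
    v ⬝ᵥ (secondMoment μ φ).mulVec v = ∫ x, (∑ i, v i * φ i x) ^ 2 ∂μ := by
  have hi (i k : ι) : Integrable (fun x => φ i x * φ k x) μ := (hφ i).integrable_mul (hφ k)
  have : ∀ x, (∑ i, v i * φ i x) ^ 2 = ∑ i, ∑ k, (v i * v k) * (φ i x * φ k x) := by
    intro x
    rw [pow_two, Finset.sum_mul_sum]
    refine Finset.sum_congr rfl fun i _ => Finset.sum_congr rfl fun k _ => by ring
  simp_rw [this]
  rw [integral_finsetSum _ fun i _ => integrable_finsetSum _ fun k _ => (hi i k).const_mul _]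
  simp only [dotProduct, Matrix.mulVec, secondMoment, Matrix.of_apply, Finset.mul_sum]
  refine Finset.sum_congr rfl fun i _ => ?_
  rw [integral_finsetSum _ fun k _ => (hi i k).const_mul _]
  refine Finset.sum_congr rfl fun k _ => ?_
  rw [integral_const_mul]
  ring

lemma posSemidef_secondMoment {φ : ι → 𝓧 → ℝ} (hφ : ∀ i, MemLp (φ i) 2 μ) :
    (secondMoment μ φ).PosSemidef := by
  refine Matrix.PosSemidef.of_dotProduct_mulVec_nonneg ?_ fun v => ?_
  · ext i k
    simp [secondMoment, mul_comm]
  · simp only [star_trivial]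
    rw [dotProduct_secondMoment hφ]
    exact integral_nonneg fun x => sq_nonneg _

/-- The **multivariate central limit theorem** for centred vectors. -/
theorem tendstoInDistribution_multivariate [DecidableEq ι] [IsProbabilityMeasure P]
    [IsProbabilityMeasure μ] (hindep : iIndepFun X P)
    (hlaw : ∀ j, HasLaw (X j) μ P) {φ : ι → 𝓧 → ℝ} (hφ : ∀ i, MemLp (φ i) 2 μ)
    (h0 : ∀ i, ∫ x, φ i x ∂μ = 0) :
    TendstoInDistribution
      (fun (n : ℕ) ω => (WithLp.toLp 2 fun i => (√n)⁻¹ * ∑ j ∈ Finset.range n, φ i (X j ω) :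
        EuclideanSpace ℝ ι)) atTop id (fun _ => P)
      (multivariateGaussian 0 (secondMoment μ φ)) := by
  have hm (i : ι) := (hφ i).aestronglyMeasurable.aemeasurable
  have hZ (n : ℕ) : AEMeasurable (fun ω => (WithLp.toLp 2 fun i =>
      (√n)⁻¹ * ∑ j ∈ Finset.range n, φ i (X j ω) : EuclideanSpace ℝ ι)) P := by
    refine (WithLp.measurable_toLp 2 (ι → ℝ)).comp_aemeasurable (aemeasurable_pi_lambda _ fun i => ?_)
    exact (Finset.aemeasurable_fun_sum _ fun j _ => aemeasurable_sample hlaw (hm i) j).const_mul _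
  refine ⟨hZ, aemeasurable_id, ?_⟩
  refine ProbabilityMeasure.tendsto_iff_tendsto_charFun.2 fun t => ?_
  simp only [ProbabilityMeasure.coe_mk, Measure.map_id]
  -- Cramér–Wold: for fixed `t`, the characteristic function of the vector at `t` is that of the
  -- scalar normalized sum of `f` at 1, so the one-dimensional theorem suffices.
  let f : 𝓧 → ℝ := fun x => ∑ i, t i * φ i x
  have hfL : MemLp f 2 μ := memLp_finsetSum _ fun i _ => (hφ i).const_mul (t i)
  have hfm := hfL.aestronglyMeasurable.aemeasurable
  have hf0 : ∫ x, f x ∂μ = 0 := by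
    rw [integral_finsetSum _ fun i _ => ((hφ i).integrable one_le_two).const_mul _]
    simp [integral_const_mul, h0]
  have hfX : MemLp (fun ω => f (X 0 ω)) 2 P :=
    ((hlaw 0).map_eq ▸ hfL : MemLp f 2 (P.map (X 0))).comp_of_map (hlaw 0).aemeasurable
  have hE : ∫ ω, f (X 0 ω) ∂P = 0 := by
    rw [← hf0]; exact (hlaw 0).integral_comp hfL.aestronglyMeasurable
  have hV : Var[fun ω => f (X 0 ω); P] = t.ofLp ⬝ᵥ (secondMoment μ φ).mulVec t.ofLp := by
    rw [dotProduct_secondMoment hφ, variance_of_integral_eq_zero hfX.aestronglyMeasurable.aemeasurable hE]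
    exact (hlaw 0).integral_comp (f := fun x => f x ^ 2) (hfL.aestronglyMeasurable.pow 2)
  have hclt := tendstoInDistribution_inv_sqrt_mul_sum_sub
    (Y := id) (P' := gaussianReal 0 Var[fun ω => f (X 0 ω); P].toNNReal) (P := P)
    (X := fun j ω => f (X j ω)) HasLaw.id hfX (iIndepFun_comp hindep hlaw hfm)
    (identDistrib_comp hlaw hfm)
  have h1 := ProbabilityMeasure.tendsto_iff_tendsto_charFun.1 hclt.tendsto 1
  simp only [ProbabilityMeasure.coe_mk, Measure.map_id] at h1
  rw [charFun_gaussianReal, Real.coe_toNNReal _ (variance_nonneg _ _), hV] at h1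
  rw [charFun_multivariateGaussian (posSemidef_secondMoment hφ)]
  convert! h1 using 1
  · ext n
    rw [charFun_apply, charFun_apply, integral_map (hZ n) (by fun_prop),
      integral_map (hclt.forall_aemeasurable n) (by fun_prop)]
    refine integral_congr_ae (.of_forall fun ω => ?_)
    simp only [hE, mul_zero, sub_zero, PiLp.inner_apply, f]
    congr 3
    rw [Finset.sum_comm]
    simp only [RCLike.inner_apply, conj_trivial, ← Finset.mul_sum, one_mul]
    rw [Finset.mul_sum]
    refine Finset.sum_congr rfl fun i _ => by ring
  · simp

/-- Pointwise convergence of characteristic functions to a limit continuous at the origin gives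
tightness of the whole sequence. Hence one radius works for every n, not only for large n. -/
lemma exists_norm_bound_of_tendstoInDistribution [IsProbabilityMeasure P] {E : Type*} [NormedAddCommGroup E]
    [InnerProductSpace ℝ E] [FiniteDimensional ℝ E] [MeasurableSpace E] [BorelSpace E]
    {Z : ℕ → Ω → E} {ν : Measure E} [IsProbabilityMeasure ν]
    (hZ : TendstoInDistribution Z atTop id (fun _ => P) ν) {ε : ℝ≥0∞} (hε : 0 < ε) :
    ∃ K : ℝ, 0 < K ∧ ∀ n, P {ω | K < ‖Z n ω‖} ≤ ε := by
  have hchar := ProbabilityMeasure.tendsto_iff_tendsto_charFun.1 hZ.tendsto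
  have hp (n : ℕ) : IsProbabilityMeasure (P.map (Z n)) :=
    Measure.isProbabilityMeasure_map (hZ.forall_aemeasurable n)
  have htight := isTightMeasureSet_of_tendsto_charFun (μ := fun n => P.map (Z n))
    (f := charFun (ν.map id)) (by fun_prop) hchar
  have := (isTightMeasureSet_iff_tendsto_measure_norm_gt).1 htight
  obtain ⟨K, hK, hK0⟩ := ((ENNReal.tendsto_nhds_zero.1 this ε hε).and (eventually_gt_atTop 0)).exists
  refine ⟨K, hK0, fun n => ?_⟩
  have h2 : P.map (Z n) {x | K < ‖x‖} ≤ ε :=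
    (le_iSup₂ (f := fun (μ : Measure E) (_ : μ ∈ Set.range fun n => P.map (Z n)) =>
      μ {x | K < ‖x‖}) _ ⟨n, rfl⟩).trans hK
  rwa [Measure.map_apply_of_aemeasurable (hZ.forall_aemeasurable n)
    (measurableSet_lt measurable_const measurable_norm)] at h2

end Limit
-- Asymptotic linearity and normality of Z-estimators
section ZEstimator

variable {𝓧 Ω : Type*} [MeasurableSpace 𝓧] [MeasurableSpace Ω] {P : Measure Ω}
  {μ : Measure 𝓧} {X : ℕ → Ω → 𝓧} {ι : Type*} [Fintype ι]

lemma secondMoment_linear {φ : ι → 𝓧 → ℝ} (hφ : ∀ i, MemLp (φ i) 2 μ) (B : Matrix ι ι ℝ) :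
    secondMoment μ (fun i x => ∑ k, B i k * φ k x) = B * secondMoment μ φ * B.transpose := by
  have hi (i k : ι) : Integrable (fun x => φ i x * φ k x) μ := (hφ i).integrable_mul (hφ k)
  ext i l
  simp only [secondMoment, Matrix.of_apply, Matrix.mul_apply, Matrix.transpose_apply]
  have : ∀ x, (∑ k, B i k * φ k x) * (∑ m, B l m * φ m x) =
      ∑ m, ∑ k, (B i k * B l m) * (φ k x * φ m x) := by
    intro x
    rw [Finset.sum_mul_sum, Finset.sum_comm]
    refine Finset.sum_congr rfl fun i _ => Finset.sum_congr rfl fun k _ => by ring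
  simp_rw [this]
  rw [integral_finsetSum _ fun i _ => integrable_finsetSum _ fun k _ => (hi k i).const_mul _]
  refine Finset.sum_congr rfl fun m _ => ?_
  rw [integral_finsetSum _ fun k _ => (hi k m).const_mul _, Finset.sum_mul]
  refine Finset.sum_congr rfl fun k _ => ?_
  rw [integral_const_mul]
  ring

lemma norm_le_sum_abs [DecidableEq ι] (v : EuclideanSpace ℝ ι) : ‖v‖ ≤ ∑ i, |v i| := by
  have h := norm_sum_le Finset.univ (fun i => v i • EuclideanSpace.single i (1 : ℝ))
  have h2 : ∑ i, v i • EuclideanSpace.single i (1 : ℝ) = v := by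
    ext k; simp [Finset.sum_apply, Pi.single_apply]
  rw [h2] at h
  simpa [norm_smul] using h

lemma abs_apply_le_norm (v : EuclideanSpace ℝ ι) (i : ι) : |v i| ≤ ‖v‖ := by
  simpa using PiLp.norm_apply_le v i

/-- Solving an approximately linear equation: if `0 = s + (A + E) Δ + R` with `B A = 1`, with
`|E i k| ≤ e` and `|R i| ≤ g ‖Δ‖²`, then `Δ` is close to `-B s`. -/
lemma norm_sub_le_of_linearized [DecidableEq ι] {A B E : Matrix ι ι ℝ} (hB : B * A = 1)
    {s R : ι → ℝ} {Δ : EuclideanSpace ℝ ι} {e g : ℝ}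
    (h0 : ∀ i, s i + ∑ k, (A i k + E i k) * Δ k + R i = 0)
    (hE : ∀ i k, |E i k| ≤ e) (hR : ∀ i, |R i| ≤ g * ‖Δ‖ ^ 2) :
    ‖Δ - WithLp.toLp 2 (fun l => ∑ i, -B l i * s i)‖ ≤
      (∑ l, ∑ i, |B l i|) * (Fintype.card ι * e + g * ‖Δ‖) * ‖Δ‖ := by
  -- Apply `B` to the equation: since `B` inverts `A`, the leading term becomes Δ and only the
  -- errors `E` and `R` are left.
  have key (l : ι) : Δ l - ∑ i, -B l i * s i = ∑ i, -B l i * (∑ k, E i k * Δ k + R i) := by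
    have h1 : ∑ i, B l i * ∑ k, A i k * Δ k = Δ l := by
      have : ∑ i, B l i * ∑ k, A i k * Δ k = ∑ k, (B * A) l k * Δ k := by
        simp only [Matrix.mul_apply, Finset.mul_sum, Finset.sum_mul]
        rw [Finset.sum_comm]
        simp only [mul_assoc]
      rw [this, hB]
      simp [Matrix.one_apply]
    have h2 : ∀ i, ∑ k, E i k * Δ k + R i = -(s i + ∑ k, A i k * Δ k) := by
      intro i
      have := h0 i
      simp only [add_mul, Finset.sum_add_distrib] at this
      linarith
    simp only [h2]
    rw [← h1, ← Finset.sum_sub_distrib]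
    exact Finset.sum_congr rfl fun i _ => by ring
  refine (norm_le_sum_abs _).trans ?_
  rw [Finset.sum_mul, Finset.sum_mul]
  refine Finset.sum_le_sum fun l _ => ?_
  rw [PiLp.sub_apply, key l]
  refine (Finset.abs_sum_le_sum_abs _ _).trans ?_
  rw [Finset.sum_mul, Finset.sum_mul]
  refine Finset.sum_le_sum fun i _ => ?_
  rw [abs_mul, abs_neg, mul_assoc]
  refine mul_le_mul_of_nonneg_left ?_ (abs_nonneg _)
  have h3 : |∑ k, E i k * Δ k| ≤ Fintype.card ι * e * ‖Δ‖ := by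
    refine (Finset.abs_sum_le_sum_abs _ _).trans ?_
    have : ∀ k ∈ Finset.univ, |E i k * Δ k| ≤ e * ‖Δ‖ := fun k _ => by
      rw [abs_mul]
      exact mul_le_mul (hE i k) (abs_apply_le_norm Δ k) (abs_nonneg _)
        ((abs_nonneg _).trans (hE i k))
    refine (Finset.sum_le_sum this).trans (le_of_eq ?_)
    simp [mul_assoc]
  calc |∑ k, E i k * Δ k + R i| ≤ |∑ k, E i k * Δ k| + |R i| := abs_add_le _ _
    _ ≤ Fintype.card ι * e * ‖Δ‖ + g * ‖Δ‖ ^ 2 := add_le_add h3 (hR i)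
    _ = _ := by ring

/-- The averaged estimating equation, linearized around `t`. -/
lemma linearized_estimating_equation {𝓧 : Type*} {t θ : EuclideanSpace ℝ ι} {r : ℝ}
    {Ψ : ι → 𝓧 → EuclideanSpace ℝ ι → ℝ} {D : ι → ι → 𝓧 → ℝ} {G : 𝓧 → ℝ} {x : ℕ → 𝓧} {n : ℕ}
    (hexp : ∀ j, ∀ θ ∈ Metric.ball t r, ∀ i,
      |Ψ i (x j) θ - Ψ i (x j) t - ∑ k, D i k (x j) * (θ k - t k)| ≤ G (x j) * ‖θ - t‖ ^ 2)
    (hθ : θ ∈ Metric.ball t r) (h0 : ∀ i, ∑ j ∈ Finset.range n, Ψ i (x j) θ = 0) (i : ι) :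
    |(∑ j ∈ Finset.range n, Ψ i (x j) t) / n +
        ∑ k, (∑ j ∈ Finset.range n, D i k (x j)) / n * (θ - t) k| ≤
      (∑ j ∈ Finset.range n, G (x j)) / n * ‖θ - t‖ ^ 2 := by
  -- Because the equations vanish at θ, the linearized expression is exactly minus the averaged
  -- Taylor remainder.
  have h1 : (∑ j ∈ Finset.range n, Ψ i (x j) t) / n +
        ∑ k, (∑ j ∈ Finset.range n, D i k (x j)) / n * (θ - t) k =
      -((∑ j ∈ Finset.range n,
        (Ψ i (x j) θ - Ψ i (x j) t - ∑ k, D i k (x j) * (θ k - t k))) / n) := by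
    rw [Finset.sum_sub_distrib, Finset.sum_sub_distrib, h0 i, Finset.sum_comm]
    simp only [PiLp.sub_apply, div_mul_eq_mul_div, ← Finset.sum_div, ← Finset.sum_mul]
    ring
  rw [h1, abs_neg, abs_div, Nat.abs_cast, div_mul_eq_mul_div, Finset.sum_mul]
  refine div_le_div_of_nonneg_right ?_ (Nat.cast_nonneg n)
  refine (Finset.abs_sum_le_sum_abs _ _).trans (Finset.sum_le_sum fun j _ => hexp j θ hθ i)

/-- **Asymptotic normality of Z-estimators.** -/
theorem tendstoInDistribution_zEstimator [DecidableEq ι] [IsProbabilityMeasure P]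
    [IsProbabilityMeasure μ] (hindep : iIndepFun X P) (hlaw : ∀ j, HasLaw (X j) μ P)
    {t : EuclideanSpace ℝ ι} {r : ℝ} (hr : 0 < r)
    {Ψ : ι → 𝓧 → EuclideanSpace ℝ ι → ℝ} {D : ι → ι → 𝓧 → ℝ} {G : 𝓧 → ℝ}
    (hΨ : ∀ i, MemLp (fun x => Ψ i x t) 2 μ) (hΨ0 : ∀ i, ∫ x, Ψ i x t ∂μ = 0)
    (hD : ∀ i k, Integrable (D i k) μ) (hG : Integrable G μ)
    (hexp : ∀ᵐ x ∂μ, ∀ θ ∈ Metric.ball t r, ∀ i,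
      |Ψ i x θ - Ψ i x t - ∑ k, D i k x * (θ k - t k)| ≤ G x * ‖θ - t‖ ^ 2)
    {B : Matrix ι ι ℝ} (hB : B * Matrix.of (fun i k => ∫ x, D i k x ∂μ) = 1)
    {θhat : ℕ → Ω → EuclideanSpace ℝ ι} (hmeas : ∀ n, AEMeasurable (θhat n) P)
    (hcons : ∀ δ : ℝ, 0 < δ → WithHighProb P (fun n ω => ‖θhat n ω - t‖ < δ))
    (hzero : WithHighProb P
      (fun n ω => ∀ i, ∑ j ∈ Finset.range n, Ψ i (X j ω) (θhat n ω) = 0)) :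
    (B * secondMoment μ (fun i x => Ψ i x t) * B.transpose).PosSemidef ∧
    TendstoInDistribution (fun (n : ℕ) ω => √n • (θhat n ω - t)) atTop id (fun _ => P)
      (multivariateGaussian 0 (B * secondMoment μ (fun i x => Ψ i x t) * B.transpose)) := by
  -- The influence function: the sign comes from solving 0 ≈ score + Jacobian · Δ, and cancels in
  -- the covariance.
  let φ : ι → 𝓧 → ℝ := fun l x => ∑ i, (-B) l i * Ψ i x t
  have hcov : secondMoment μ φ = B * secondMoment μ (fun i x => Ψ i x t) * B.transpose := by
    rw [secondMoment_linear hΨ]; simp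
  have hφ (l : ι) : MemLp (φ l) 2 μ := memLp_finsetSum _ fun i _ => (hΨ i).const_mul _
  have hφ0 (l : ι) : ∫ x, φ l x ∂μ = 0 := by
    rw [integral_finsetSum _ fun i _ => ((hΨ i).integrable one_le_two).const_mul _]
    simp only [integral_const_mul, hΨ0, mul_zero, Finset.sum_const_zero]
  have hclt := tendstoInDistribution_multivariate hindep hlaw hφ hφ0
  rw [hcov] at hclt
  refine ⟨hcov ▸ posSemidef_secondMoment hφ, ?_⟩
  have hT (n : ℕ) : AEMeasurable (fun ω => √n • (θhat n ω - t)) P :=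
    ((hmeas n).sub_const t).const_smul (√n)
  -- Slutsky: it remains to show that the rescaled estimator and the normalized sum of influence
  -- functions differ by a quantity tending to zero in probability.
  refine tendstoInDistribution_of_tendstoInMeasure_sub _ _ hclt ?_ hT
  set Z : ℕ → Ω → EuclideanSpace ℝ ι := fun n ω =>
    WithLp.toLp 2 fun i => (√n)⁻¹ * ∑ j ∈ Finset.range n, φ i (X j ω) with hZdef
  refine tendstoInMeasure_iff_norm.2 fun ε hε => ?_
  refine ENNReal.tendsto_nhds_zero.2 fun ε' hε' => ?_
  have hε'2 : 0 < ε' / 2 := ENNReal.half_pos hε'.ne'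
  obtain ⟨K, hK, hKb⟩ := exists_norm_bound_of_tendstoInDistribution hclt hε'2
  -- The added ones keep the constants positive; in `g` the one also absorbs the error of the law of
  -- large numbers. The bound η ≤ 1/2 lets the error be absorbed into the left side, and η ≤ ε/(4K)
  -- makes it at most ε/2. The Jacobian tolerance `e` and the radius `δ` are chosen so that b(ce +
  -- gδ) = η.
  let g : ℝ := |∫ x, G x ∂μ| + 1
  have hg : 0 < g := by positivity
  let b : ℝ := (∑ l, ∑ i, |B l i|) + 1
  have hb : 0 < b := by positivity
  let c : ℝ := Fintype.card ι + 1
  have hc : 0 < c := by positivity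
  let η : ℝ := min (1 / 2) (ε / (4 * K))
  have hη : 0 < η := by positivity
  let e : ℝ := η / (2 * b * c)
  have he : 0 < e := by positivity
  let δ : ℝ := η / (2 * b * g)
  have hδ : 0 < δ := by positivity
  have hall := ((((WithHighProb.all fun i => WithHighProb.all fun k =>
      law_of_large_numbers hindep hlaw (hD i k) he).and
      (law_of_large_numbers hindep hlaw hG one_pos)).and
      ((hcons δ hδ).and (hcons r hr))).and hzero).and
      (WithHighProb.of_ae ((ae_forall_sample hlaw hexp).mono fun ω h (_ : ℕ) => h))
  have hev := ENNReal.tendsto_nhds_zero.1 hall (ε' / 2) hε'2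
  filter_upwards [hev, eventually_gt_atTop 0] with n hn hn0
  refine le_trans ?_ (ENNReal.add_halves ε').le
  refine le_trans (measure_mono ?_) ((measure_union_le _ _).trans (add_le_add (hKb n) hn))
  intro ω hω
  by_contra hcon
  simp only [Set.mem_union, Set.mem_ofPred_eq, not_or, not_not, not_lt] at hcon
  obtain ⟨hZK, ⟨⟨⟨hDn, hGn⟩, hδn, hrn⟩, hzn⟩, hexpn⟩ := hcon
  have hn' : (0 : ℝ) < n := Nat.cast_pos.2 hn0
  have hsn : 0 < √(n : ℝ) := Real.sqrt_pos.2 hn'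
  set Δ := θhat n ω - t with hΔ
  have hlin := linearized_estimating_equation hexpn (mem_ball_iff_norm.2 hrn) hzn
  have hGle : (∑ j ∈ Finset.range n, G (X j ω)) / n ≤ g := by
    have h1 := (abs_lt.1 hGn).2
    have h2 := le_abs_self (∫ x, G x ∂μ)
    simp only [g]; linarith
  let S : ι → ℝ := fun i => (∑ j ∈ Finset.range n, Ψ i (X j ω) t) / n
  -- `E` is the deviation of the empirical Jacobian from its mean. The remainder `R` is defined so
  -- that the linear equation holds identically; `hlin` then supplies its quadratic bound.
  have hmain := norm_sub_le_of_linearized (E := Matrix.of fun i k =>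
      (∑ j ∈ Finset.range n, D i k (X j ω)) / n - ∫ x, D i k x ∂μ) (Δ := Δ) (e := e) (g := g)
      (s := S) (R := fun i => -(S i + ∑ k, (∑ j ∈ Finset.range n, D i k (X j ω)) / n * Δ k))
      hB (fun i => by simp) (fun i k => (hDn i k).le) (fun i => by
        rw [abs_neg]
        exact (hlin i).trans (mul_le_mul_of_nonneg_right hGle (sq_nonneg _)))
  have hZφ : WithLp.toLp 2 (fun l => ∑ i, -B l i * S i) = (√(n : ℝ))⁻¹ • Z n ω := by
    ext l
    simp only [hZdef, PiLp.smul_apply, smul_eq_mul, S, φ]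
    rw [← mul_assoc, ← mul_inv, Real.mul_self_sqrt hn'.le, Finset.sum_comm, Finset.mul_sum]
    refine Finset.sum_congr rfl fun i _ => ?_
    rw [← Finset.mul_sum]
    simp only [Matrix.neg_apply]
    ring
  rw [hZφ] at hmain
  have hfac : (∑ l, ∑ i, |B l i|) * (Fintype.card ι * e + g * ‖Δ‖) ≤ η := by
    have h1 : (Fintype.card ι : ℝ) * e ≤ c * e :=
      mul_le_mul_of_nonneg_right (by simp [c]) he.le
    have h2 : g * ‖Δ‖ ≤ g * δ := mul_le_mul_of_nonneg_left hδn.le hg.le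
    calc (∑ l, ∑ i, |B l i|) * (Fintype.card ι * e + g * ‖Δ‖) ≤ b * (c * e + g * δ) := by
          refine mul_le_mul (by simp [b]) (add_le_add h1 h2) (by positivity) hb.le
      _ = η := by simp only [e, δ]; field_simp; ring
  have h3 : ‖Δ - (√(n : ℝ))⁻¹ • Z n ω‖ ≤ η * ‖Δ‖ :=
    hmain.trans (mul_le_mul_of_nonneg_right hfac (norm_nonneg _))
  have h4 : ‖√(n : ℝ) • Δ - Z n ω‖ ≤ η * ‖√(n : ℝ) • Δ‖ := by
    have h5 : √(n : ℝ) • Δ - Z n ω = √(n : ℝ) • (Δ - (√(n : ℝ))⁻¹ • Z n ω) := by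
      rw [smul_sub _ Δ, smul_smul, mul_inv_cancel₀ hsn.ne', one_smul]
    rw [h5, norm_smul, norm_smul]
    calc _ ≤ ‖√(n : ℝ)‖ * (η * ‖Δ‖) := mul_le_mul_of_nonneg_left h3 (norm_nonneg _)
      _ = _ := by ring
  have hη1 : η ≤ 1 / 2 := min_le_left _ _
  have hη2 : η ≤ ε / (4 * K) := min_le_right _ _
  -- Self-bounding: the error is at most half the norm being estimated, so that norm is at most
  -- twice the bound on `Z`. This gives the √n rate from consistency alone.
  have h6 : ‖√(n : ℝ) • Δ‖ ≤ 2 * K := by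
    have h7 := norm_le_norm_add_norm_sub' (√(n : ℝ) • Δ) (Z n ω)
    have h8 : η * ‖√(n : ℝ) • Δ‖ ≤ 1 / 2 * ‖√(n : ℝ) • Δ‖ :=
      mul_le_mul_of_nonneg_right hη1 (norm_nonneg _)
    linarith
  have h9 : ‖√(n : ℝ) • Δ - Z n ω‖ ≤ ε / 2 := by
    calc _ ≤ η * ‖√(n : ℝ) • Δ‖ := h4
      _ ≤ ε / (4 * K) * (2 * K) := mul_le_mul hη2 h6 (norm_nonneg _) (by positivity)
      _ = ε / 2 := by field_simp; ring
  have h10 : ε ≤ ‖√(n : ℝ) • Δ - Z n ω‖ := by simpa using hω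
  linarith

end ZEstimator
/-! ### Calculus with partial derivatives -/

section Calculus

lemma differentiableAt_of_contDiffOn {E : Type*} [NormedAddCommGroup E] [NormedSpace ℝ E]
    {F : E → ℝ} {U : Set E}
    (hU : IsOpen U) {n : WithTop ℕ∞} (hF : ContDiffOn ℝ n F U) (hn : n ≠ 0)
    {θ : E} (hθ : θ ∈ U) : DifferentiableAt ℝ F θ :=
  (hF.differentiableOn hn).differentiableAt (hU.mem_nhds hθ)

variable {ι : Type*} [Fintype ι] [DecidableEq ι]

lemma fderiv_apply_eq_sum (h : EuclideanSpace ℝ ι → ℝ) (θ v : EuclideanSpace ℝ ι) :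
    fderiv ℝ h θ v = ∑ k, v k * partialDeriv k h θ := by
  have h2 : v = ∑ i, v i • EuclideanSpace.single i (1 : ℝ) := by
    ext k; simp [Finset.sum_apply, Pi.single_apply]
  conv_lhs => rw [h2]
  simp [partialDeriv]

/-- The truncation `max g 0` matters only for an empty index type, where the hypothesis does not
force `g` to be nonnegative. -/
lemma norm_fderiv_le_of_partialDeriv {h : EuclideanSpace ℝ ι → ℝ} {θ : EuclideanSpace ℝ ι} {g : ℝ}
    (hb : ∀ k, |partialDeriv k h θ| ≤ g) : ‖fderiv ℝ h θ‖ ≤ Fintype.card ι * max g 0 := by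
  refine ContinuousLinearMap.opNorm_le_bound _ (by positivity) fun v => ?_
  rw [fderiv_apply_eq_sum]
  refine (Finset.abs_sum_le_sum_abs _ _).trans ?_
  have : ∀ k ∈ Finset.univ, |v k * partialDeriv k h θ| ≤ max g 0 * ‖v‖ := fun k _ => by
    rw [abs_mul, mul_comm]
    exact mul_le_mul ((hb k).trans (le_max_left _ _)) (abs_apply_le_norm v k) (abs_nonneg _)
      (le_max_right _ _)
  refine (Finset.sum_le_sum this).trans (le_of_eq ?_)
  simp [mul_assoc]

lemma abs_sub_le_of_partialDeriv {h : EuclideanSpace ℝ ι → ℝ} {s : Set (EuclideanSpace ℝ ι)}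
    (hs : Convex ℝ s) (hd : ∀ θ ∈ s, DifferentiableAt ℝ h θ) {g : ℝ}
    (hb : ∀ θ ∈ s, ∀ k, |partialDeriv k h θ| ≤ g) {a b : EuclideanSpace ℝ ι} (ha : a ∈ s)
    (hb' : b ∈ s) : |h b - h a| ≤ Fintype.card ι * max g 0 * ‖b - a‖ :=
  hs.norm_image_sub_le_of_norm_fderiv_le hd
    (fun θ hθ => norm_fderiv_le_of_partialDeriv (hb θ hθ)) ha hb'

/-- First-order Taylor expansion with a quadratic remainder. -/
lemma abs_taylor_le {h : EuclideanSpace ℝ ι → ℝ} {s : Set (EuclideanSpace ℝ ι)}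
    (hs : Convex ℝ s) (hd : ∀ θ ∈ s, DifferentiableAt ℝ h θ)
    (hd2 : ∀ θ ∈ s, ∀ k, DifferentiableAt ℝ (partialDeriv k h) θ) {g : ℝ}
    (hb : ∀ θ ∈ s, ∀ j k, |partialDeriv j (partialDeriv k h) θ| ≤ g)
    {t θ : EuclideanSpace ℝ ι} (ht : t ∈ s) (hθ : θ ∈ s) :
    |h θ - h t - ∑ k, partialDeriv k h t * (θ k - t k)| ≤
      (Fintype.card ι : ℝ) ^ 2 * max g 0 * ‖θ - t‖ ^ 2 := by
  have hseg : segment ℝ t θ ⊆ s := hs.segment_subset ht hθ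
  -- The mean value inequality is used twice: here on each partial derivative, to bound the gradient
  -- of h minus its linear part along the segment, then on that difference itself.
  have h1 : ∀ u ∈ segment ℝ t θ, ∀ k,
      |partialDeriv k (fun v => h v - fderiv ℝ h t v) u| ≤
        Fintype.card ι * max g 0 * ‖θ - t‖ := by
    intro u hu k
    have h2 : partialDeriv k (fun v => h v - fderiv ℝ h t v) u =
        partialDeriv k h u - partialDeriv k h t := by
      unfold partialDeriv
      rw [fderiv_fun_sub (hd u (hseg hu)) (by fun_prop), ContinuousLinearMap.fderiv]
      rfl
    rw [h2]
    refine (abs_sub_le_of_partialDeriv hs (fun v hv => hd2 v hv k) (fun v hv j => hb v hv j k)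
      ht (hseg hu)).trans ?_
    refine mul_le_mul_of_nonneg_left ?_ (by positivity)
    exact norm_sub_le_of_mem_segment hu
  have h3 := abs_sub_le_of_partialDeriv (convex_segment t θ)
    (fun u hu => (hd u (hseg hu)).sub (by fun_prop)) h1 (left_mem_segment ℝ t θ)
    (right_mem_segment ℝ t θ)
  have h4 : h θ - h t - ∑ k, partialDeriv k h t * (θ k - t k) =
      h θ - fderiv ℝ h t θ - (h t - fderiv ℝ h t t) := by
    have := fderiv_apply_eq_sum h t (θ - t)
    rw [map_sub] at this
    simp only [PiLp.sub_apply, mul_comm (θ.ofLp _ - t.ofLp _)] at this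
    rw [← this]; ring
  rw [h4]
  refine h3.trans (le_of_eq ?_)
  rw [max_eq_left (by positivity)]
  ring

lemma contDiffOn_partialDeriv {F : EuclideanSpace ℝ ι → ℝ} {U : Set (EuclideanSpace ℝ ι)}
    (hU : IsOpen U) {m n : WithTop ℕ∞} (hF : ContDiffOn ℝ n F U) (hmn : m + 1 ≤ n) (i : ι) :
    ContDiffOn ℝ m (partialDeriv i F) U :=
  (hF.fderiv_of_isOpen hU hmn).clm_apply contDiffOn_const

lemma hasDerivAt_line {F : EuclideanSpace ℝ ι → ℝ} {t : EuclideanSpace ℝ ι} {i : ι} {s : ℝ}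
    (hF : DifferentiableAt ℝ F (t + s • EuclideanSpace.single i 1)) :
    HasDerivAt (fun u : ℝ => F (t + u • EuclideanSpace.single i 1))
      (partialDeriv i F (t + s • EuclideanSpace.single i 1)) s := by
  have h1 : HasDerivAt (fun u : ℝ => t + u • EuclideanSpace.single i (1 : ℝ))
      (EuclideanSpace.single i 1) s := by
    simpa using ((hasDerivAt_id s).smul_const (EuclideanSpace.single i (1 : ℝ))).const_add t
  exact hF.hasFDerivAt.comp_hasDerivAt s h1

/-- Fermat's rule along one coordinate line. Maximality is needed in that direction only, since the
second stage maximizes over θ₂ alone. -/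
lemma sum_partialDeriv_eq_zero {F : ℕ → EuclideanSpace ℝ ι → ℝ} {t : EuclideanSpace ℝ ι} {i : ι}
    {n : ℕ} (hd : ∀ j, DifferentiableAt ℝ (F j) t)
    (hmax : IsLocalMax (fun s : ℝ => ∑ j ∈ Finset.range n, F j (t + s • EuclideanSpace.single i 1))
      0) : ∑ j ∈ Finset.range n, partialDeriv i (F j) t = 0 := by
  have h := HasDerivAt.fun_sum (u := Finset.range n) fun j _ =>
    hasDerivAt_line (F := F j) (t := t) (i := i) (s := 0) (by simpa using hd j)
  simpa using hmax.hasDerivAt_eq_zero h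

variable {𝓧 : Type*} [MeasurableSpace 𝓧] {μ : Measure 𝓧}

/-- A derivative is a sequential limit of difference quotients, so measurability in x at each fixed
parameter suffices and no joint measurability enters. Applying it twice handles the Hessian. -/
lemma aemeasurable_partialDeriv {F : 𝓧 → EuclideanSpace ℝ ι → ℝ} {U : Set (EuclideanSpace ℝ ι)}
    (hU : IsOpen U) (hm : ∀ θ ∈ U, AEMeasurable (fun x => F x θ) μ)
    (hd : ∀ᵐ x ∂μ, ∀ θ ∈ U, DifferentiableAt ℝ (F x) θ) {θ : EuclideanSpace ℝ ι} (hθ : θ ∈ U)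
    (i : ι) : AEMeasurable (fun x => partialDeriv i (F x) θ) μ := by
  let c : ℕ → ℝ := fun n => n
  have hc : Tendsto c atTop atTop := tendsto_natCast_atTop_atTop
  have hlim : Tendsto (fun n => θ + (c n)⁻¹ • EuclideanSpace.single i (1 : ℝ)) atTop (𝓝 θ) := by
    have := ((tendsto_inv_atTop_zero.comp hc).smul_const (EuclideanSpace.single i (1 : ℝ)))
    simpa using this.const_add θ
  -- The shift by `N` keeps every difference quotient inside `U`, where measurability is assumed.
  obtain ⟨N, hN⟩ := eventually_atTop.1 (hlim.eventually (hU.mem_nhds hθ))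
  refine aemeasurable_of_tendsto_metrizable_ae' (f := fun n x =>
    c (n + N) • (F x (θ + (c (n + N))⁻¹ • EuclideanSpace.single i (1 : ℝ)) - F x θ)) ?_ ?_
  · intro n
    exact ((hm _ (hN _ (Nat.le_add_left N n))).sub (hm θ hθ)).const_smul (c (n + N))
  · filter_upwards [hd] with x hx
    refine (hx θ hθ).hasFDerivAt.lim _ ?_
    exact (tendsto_norm_atTop_atTop.comp hc).comp (tendsto_add_atTop_nat N)

/-- If `E F(x, ·)` has a local maximum at `t` along the `i`-th coordinate, then the `i`-th score
is centred at `t`. -/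
lemma integral_partialDeriv_eq_zero {F : 𝓧 → EuclideanSpace ℝ ι → ℝ}
    {U : Set (EuclideanSpace ℝ ι)} (hU : IsOpen U)
    (hint : ∀ θ ∈ U, Integrable (fun x => F x θ) μ)
    (hd : ∀ᵐ x ∂μ, ∀ θ ∈ U, DifferentiableAt ℝ (F x) θ) {t : EuclideanSpace ℝ ι} (ht : t ∈ U)
    {i : ι} {G : 𝓧 → ℝ} (hG : Integrable G μ)
    (hb : ∀ᵐ x ∂μ, ∀ θ ∈ U, |partialDeriv i (F x) θ| ≤ G x)
    (hmax : IsLocalMax (fun s : ℝ => ∫ x, F x (t + s • EuclideanSpace.single i 1) ∂μ) 0) :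
    ∫ x, partialDeriv i (F x) t ∂μ = 0 := by
  have hcont : Continuous fun s : ℝ => t + s • EuclideanSpace.single i (1 : ℝ) := by fun_prop
  let S : Set ℝ := {s | t + s • EuclideanSpace.single i (1 : ℝ) ∈ U}
  have hS : S ∈ 𝓝 (0 : ℝ) := (hU.preimage hcont).mem_nhds (by simpa [S] using ht)
  have h0 : t + (0 : ℝ) • EuclideanSpace.single i (1 : ℝ) ∈ U := by simpa using ht
  have h := (hasDerivAt_integral_of_dominated_loc_of_deriv_le (μ := μ) (x₀ := (0 : ℝ)) (s := S)
    (F := fun s x => F x (t + s • EuclideanSpace.single i 1))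
    (F' := fun s x => partialDeriv i (F x) (t + s • EuclideanSpace.single i 1)) (bound := G) hS
    ?_ ?_ ?_ ?_ hG ?_).2
  · simpa using hmax.hasDerivAt_eq_zero h
  · filter_upwards [hS] with s hs using (hint _ hs).aestronglyMeasurable
  · exact hint _ (h0)
  · exact (aemeasurable_partialDeriv hU (fun θ hθ => (hint θ hθ).aestronglyMeasurable.aemeasurable)
      hd (h0) i).aestronglyMeasurable
  · filter_upwards [hb] with x hx s hs using hx _ hs
  · filter_upwards [hd] with x hx s hs using hasDerivAt_line (hx _ hs)

end Calculus
/-! ### Geometry of concatenated parameters -/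

section Join

variable {d₁ d₂ : ℕ}

@[simp] lemma fstPart_join (a : EuclideanSpace ℝ (Fin d₁)) (b : EuclideanSpace ℝ (Fin d₂)) :
    fstPart (join a b) = a := rfl

@[simp] lemma sndPart_join (a : EuclideanSpace ℝ (Fin d₁)) (b : EuclideanSpace ℝ (Fin d₂)) :
    sndPart (join a b) = b := rfl

@[simp] lemma join_fstPart_sndPart (θ : EuclideanSpace ℝ (Fin d₁ ⊕ Fin d₂)) :
    join (fstPart θ) (sndPart θ) = θ := by
  ext i
  cases i <;> rfl

lemma join_sub_join (a c : EuclideanSpace ℝ (Fin d₁)) (b d : EuclideanSpace ℝ (Fin d₂)) :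
    join (a - c) (b - d) = join a b - join c d := by
  ext i
  cases i <;> rfl

lemma norm_sq_eq_parts (θ : EuclideanSpace ℝ (Fin d₁ ⊕ Fin d₂)) :
    ‖θ‖ ^ 2 = ‖fstPart θ‖ ^ 2 + ‖sndPart θ‖ ^ 2 := by
  simp only [EuclideanSpace.real_norm_sq_eq, Fintype.sum_sum_type]
  rfl

lemma norm_fstPart_le (θ : EuclideanSpace ℝ (Fin d₁ ⊕ Fin d₂)) : ‖fstPart θ‖ ≤ ‖θ‖ :=
  abs_le_of_sq_le_sq' (by rw [norm_sq_eq_parts θ]; nlinarith [sq_nonneg ‖sndPart θ‖])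
    (norm_nonneg _) |>.2

lemma norm_sndPart_le (θ : EuclideanSpace ℝ (Fin d₁ ⊕ Fin d₂)) : ‖sndPart θ‖ ≤ ‖θ‖ :=
  abs_le_of_sq_le_sq' (by rw [norm_sq_eq_parts θ]; nlinarith [sq_nonneg ‖fstPart θ‖])
    (norm_nonneg _) |>.2

lemma norm_join_le (a : EuclideanSpace ℝ (Fin d₁)) (b : EuclideanSpace ℝ (Fin d₂)) :
    ‖join a b‖ ≤ ‖a‖ + ‖b‖ := by
  refine abs_le_of_sq_le_sq' ?_ (by positivity) |>.2
  rw [norm_sq_eq_parts, fstPart_join, sndPart_join]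
  nlinarith [mul_nonneg (norm_nonneg a) (norm_nonneg b)]

lemma isLinearMap_fstPart : IsLinearMap ℝ (fstPart : EuclideanSpace ℝ (Fin d₁ ⊕ Fin d₂) → _) :=
  ⟨fun _ _ => rfl, fun _ _ => rfl⟩

lemma isLinearMap_sndPart : IsLinearMap ℝ (sndPart : EuclideanSpace ℝ (Fin d₁ ⊕ Fin d₂) → _) :=
  ⟨fun _ _ => rfl, fun _ _ => rfl⟩

lemma continuous_fstPart : Continuous (fstPart : EuclideanSpace ℝ (Fin d₁ ⊕ Fin d₂) → _) :=
  (isLinearMap_fstPart.mk' _).continuous_of_finiteDimensional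

lemma continuous_sndPart : Continuous (sndPart : EuclideanSpace ℝ (Fin d₁ ⊕ Fin d₂) → _) :=
  (isLinearMap_sndPart.mk' _).continuous_of_finiteDimensional

lemma continuous_join : Continuous fun p : EuclideanSpace ℝ (Fin d₁) × EuclideanSpace ℝ (Fin d₂) =>
    join p.1 p.2 := by
  refine (PiLp.continuous_toLp 2 _).comp (continuous_pi fun i => ?_)
  cases i <;> simp only [Sum.elim_inl, Sum.elim_inr] <;> fun_prop

/-- The product of two sets of parameters, as a set of concatenated parameters. -/
def joinSet (A : Set (EuclideanSpace ℝ (Fin d₁))) (B : Set (EuclideanSpace ℝ (Fin d₂))) :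
    Set (EuclideanSpace ℝ (Fin d₁ ⊕ Fin d₂)) :=
  {θ | fstPart θ ∈ A ∧ sndPart θ ∈ B}

lemma isOpen_joinSet {A : Set (EuclideanSpace ℝ (Fin d₁))} {B : Set (EuclideanSpace ℝ (Fin d₂))}
    (hA : IsOpen A) (hB : IsOpen B) : IsOpen (joinSet A B) :=
  (hA.preimage continuous_fstPart).inter (hB.preimage continuous_sndPart)

lemma convex_joinSet {A : Set (EuclideanSpace ℝ (Fin d₁))} {B : Set (EuclideanSpace ℝ (Fin d₂))}
    (hA : Convex ℝ A) (hB : Convex ℝ B) : Convex ℝ (joinSet A B) :=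
  (hA.is_linear_preimage isLinearMap_fstPart).inter (hB.is_linear_preimage isLinearMap_sndPart)

lemma fstPart_add_single_inr (θ : EuclideanSpace ℝ (Fin d₁ ⊕ Fin d₂)) (s : ℝ) (i : Fin d₂) :
    fstPart (θ + s • EuclideanSpace.single (Sum.inr i) 1) = fstPart θ := by
  ext k; simp [fstPart]

lemma sndPart_add_single_inr (θ : EuclideanSpace ℝ (Fin d₁ ⊕ Fin d₂)) (s : ℝ) (i : Fin d₂) :
    sndPart (θ + s • EuclideanSpace.single (Sum.inr i) 1) =
      sndPart θ + s • EuclideanSpace.single i 1 := by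
  ext k; simp [sndPart]

end Join

/-! ### Extended-real log likelihood ratios -/

lemma ereal_coe_sum (s : Finset ℕ) (a : ℕ → ℝ) :
    ((∑ j ∈ s, a j : ℝ) : EReal) = ∑ j ∈ s, (a j : EReal) := by
  induction s using Finset.cons_induction with
  | empty => simp
  | cons j s hj ih => rw [Finset.sum_cons, Finset.sum_cons, EReal.coe_add, ih]

/-- The contradiction behind both consistency proofs: an estimate that beats a competitor `b`,
itself nearly as good as the reference `a`, cannot lie in the separated region. The terms of `e`
stay extended real because the estimate is not yet known to lie where the likelihood is positive. -/
lemma not_average_ratio_le {e : ℕ → EReal} {a b : ℕ → ℝ} {n : ℕ} {ε : ℝ}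
    (h : ((∑ j ∈ Finset.range n, b j : ℝ) : EReal) ≤ ∑ j ∈ Finset.range n, e j)
    (hb : -ε < (∑ j ∈ Finset.range n, (b j - a j)) / n) :
    ¬ (∑ j ∈ Finset.range n, (e j - (a j : EReal))) / (n : EReal) ≤ ((-ε : ℝ) : EReal) := by
  rw [not_le]
  have h1 : ((∑ j ∈ Finset.range n, (b j - a j) : ℝ) : EReal) ≤
      ∑ j ∈ Finset.range n, (e j - (a j : EReal)) := by
    simp only [sub_eq_add_neg, Finset.sum_add_distrib, EReal.coe_add]
    refine add_le_add h (le_of_eq ?_)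
    rw [ereal_coe_sum]
    simp
  refine lt_of_lt_of_le (EReal.coe_lt_coe_iff.2 hb) ?_
  rw [EReal.coe_div, EReal.coe_natCast]
  exact EReal.div_le_div_right_of_nonneg (by exact_mod_cast Nat.zero_le n) h1

namespace CutModel

variable {𝓧₁ 𝓧₂ : Type*} [MeasurableSpace 𝓧₁] [MeasurableSpace 𝓧₂] {d₁ d₂ : ℕ}
  {M : CutModel 𝓧₁ 𝓧₂ d₁ d₂}

lemma elogLik₁_eq_coe {x : 𝓧₁} {θ₁ : EuclideanSpace ℝ (Fin d₁)} (h : 0 < M.f₁ x θ₁) :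
    M.elogLik₁ x θ₁ = (M.logLik₁ x θ₁ : EReal) :=
  ENNReal.log_pos_real (by exact_mod_cast h.ne') (by simp)

lemma elogLik₂_eq_coe {x : 𝓧₂} {θ₁ : EuclideanSpace ℝ (Fin d₁)} {θ₂ : EuclideanSpace ℝ (Fin d₂)}
    (h : 0 < M.f₂ x θ₁ θ₂) : M.elogLik₂ x θ₁ θ₂ = (M.logLik₂ x θ₁ θ₂ : EReal) :=
  ENNReal.log_pos_real (by exact_mod_cast h.ne') (by simp)

/-! ### First-order conditions -/

/-- An estimate inside the open set `B` is an interior maximizer. Positivity on `B` turns the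
extended-real comparison into a real one, to which Fermat's rule applies. -/
lemma IsTwoStageMLE.sum_score₁ {n : ℕ} {x : ℕ → 𝓧₁ × 𝓧₂} {a : EuclideanSpace ℝ (Fin d₁)}
    {b : EuclideanSpace ℝ (Fin d₂)} (h : M.IsTwoStageMLE n x a b)
    {B : Set (EuclideanSpace ℝ (Fin d₁))} (hB : IsOpen B) (hBΘ : B ⊆ M.Θ₁) (ha : a ∈ B)
    (hx : ∀ j, (∀ θ₁ ∈ B, 0 < M.f₁ (x j).1 θ₁) ∧ ContDiffOn ℝ 3 (M.logLik₁ (x j).1) B)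
    (i : Fin d₁) : ∑ j ∈ Finset.range n, partialDeriv i (M.logLik₁ (x j).1) a = 0 := by
  refine sum_partialDeriv_eq_zero
    (fun j => differentiableAt_of_contDiffOn hB (hx j).2 (by norm_num) ha) ?_
  have hcont : Continuous fun s : ℝ => a + s • EuclideanSpace.single i (1 : ℝ) := by fun_prop
  filter_upwards [(hB.preimage hcont).mem_nhds (by simpa using ha : (0 : ℝ) ∈ _)] with s hs
  have h1 := h.1.2 _ (hBΘ hs)
  simp only [elogLik₁_eq_coe ((hx _).1 _ hs), elogLik₁_eq_coe ((hx _).1 _ ha), ← ereal_coe_sum,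
    EReal.coe_le_coe_iff] at h1
  simpa using h1

lemma IsTwoStageMLE.sum_score₂ {n : ℕ} {x : ℕ → 𝓧₁ × 𝓧₂} {a : EuclideanSpace ℝ (Fin d₁)}
    {b : EuclideanSpace ℝ (Fin d₂)} (h : M.IsTwoStageMLE n x a b)
    {A : Set (EuclideanSpace ℝ (Fin d₁))} {B : Set (EuclideanSpace ℝ (Fin d₂))} (hA : IsOpen A)
    (hB : IsOpen B) (hBΘ : B ⊆ M.Θ₂) (ha : a ∈ A) (hb : b ∈ B)
    (hx : ∀ j, (∀ θ₁ ∈ A, ∀ θ₂ ∈ B, 0 < M.f₂ (x j).2 θ₁ θ₂) ∧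
      ContDiffOn ℝ 3 (M.jointLogLik₂ (x j).2) (joinSet A B)) (i : Fin d₂) :
    ∑ j ∈ Finset.range n, partialDeriv (Sum.inr i) (M.jointLogLik₂ (x j).2) (join a b) = 0 := by
  refine sum_partialDeriv_eq_zero (fun j =>
    differentiableAt_of_contDiffOn (isOpen_joinSet hA hB) (hx j).2 (by norm_num) ⟨ha, hb⟩) ?_
  have hcont : Continuous fun s : ℝ => b + s • EuclideanSpace.single i (1 : ℝ) := by fun_prop
  filter_upwards [(hB.preimage hcont).mem_nhds (by simpa using hb : (0 : ℝ) ∈ _)] with s hs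
  have h1 := h.2.2 _ (hBΘ hs)
  simp only [elogLik₂_eq_coe ((hx _).1 _ ha _ hs), elogLik₂_eq_coe ((hx _).1 _ ha _ hb),
    ← ereal_coe_sum, EReal.coe_le_coe_iff] at h1
  simpa [jointLogLik₂, fstPart_add_single_inr, sndPart_add_single_inr] using h1

/-! ### Consistency -/

section Consistency

variable {Ω : Type*} [MeasurableSpace Ω] {P : Measure Ω}
  {Pstar : Measure (𝓧₁ × 𝓧₂)} {X : ℕ → Ω → 𝓧₁ × 𝓧₂}
  {t₁ : EuclideanSpace ℝ (Fin d₁)} {t₂ : EuclideanSpace ℝ (Fin d₂)}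
  {θhat₁ : ℕ → Ω → EuclideanSpace ℝ (Fin d₁)} {θhat₂ : ℕ → Ω → EuclideanSpace ℝ (Fin d₂)}

lemma ae_forall_fst (hlaw : ∀ j, HasLaw (X j) Pstar P) {p : 𝓧₁ → Prop}
    (hp : ∀ᵐ x ∂Pstar.fst, p x) : ∀ᵐ ω ∂P, ∀ j, p (X j ω).1 :=
  ae_forall_sample hlaw (p := fun x => p x.1) (ae_of_ae_map measurable_fst.aemeasurable hp)

lemma ae_forall_snd (hlaw : ∀ j, HasLaw (X j) Pstar P) {p : 𝓧₂ → Prop}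
    (hp : ∀ᵐ x ∂Pstar.snd, p x) : ∀ᵐ ω ∂P, ∀ j, p (X j ω).2 :=
  ae_forall_sample hlaw (p := fun x => p x.2) (ae_of_ae_map measurable_snd.aemeasurable hp)

/-- Wald's argument with `t₁` itself as competitor: the maximizer has nonnegative log likelihood
ratio against `t₁`, which separation excludes at distance δ or more. -/
lemma consistent₁ [IsProbabilityMeasure P] (hlaw : ∀ j, HasLaw (X j) Pstar P) (ht₁ : t₁ ∈ M.Θ₁)
    (hpos : ∀ᵐ x ∂Pstar.fst, 0 < M.f₁ x t₁) (hsep : M.Separated₁ P X t₁)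
    (hmeas : ∀ n, AEMeasurable (θhat₁ n) P)
    (hMLE : WithHighProb P
      fun n ω => M.IsTwoStageMLE n (fun j => X j ω) (θhat₁ n ω) (θhat₂ n ω))
    {δ : ℝ} (hδ : 0 < δ) : WithHighProb P fun n ω => ‖θhat₁ n ω - t₁‖ < δ := by
  obtain ⟨ε, hε, hA⟩ := hsep δ hδ
  refine WithHighProb.of_tendsto_one hA (hMLE.and (WithHighProb.of_ae
    ((ae_forall_fst hlaw hpos).mono fun ω h (_ : ℕ) => h))) (fun n => nullMeasurableSet_lt
      ((hmeas n).sub_const t₁).norm aemeasurable_const) ?_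
  rintro n ω hsup ⟨hM, hp⟩
  by_contra hδn
  rw [not_lt] at hδn
  have h1 := (le_iSup₂ (f := fun θ₁ (_ : θ₁ ∈ {θ₁ | θ₁ ∈ M.Θ₁ ∧ δ ≤ ‖θ₁ - t₁‖}) =>
    (∑ j ∈ Finset.range n, (M.elogLik₁ (X j ω).1 θ₁ - M.elogLik₁ (X j ω).1 t₁)) / (n : EReal))
    (θhat₁ n ω) ⟨hM.1.1, hδn⟩).trans hsup
  have h2 := hM.1.2 t₁ ht₁
  simp only [elogLik₁_eq_coe (hp _), ← ereal_coe_sum] at h1 h2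
  exact not_average_ratio_le h2 (by simpa using hε) h1

/-- Maximality of θ̂₂ only allows a comparison with (θ̂₁, t₂), whereas separation refers to (t₁,
t₂). The gap between these two points is bounded by the averaged Lipschitz constant times ‖θ̂₁ -
t₁‖, which first-stage consistency makes smaller than the separation margin. -/
lemma consistent₂ [IsProbabilityMeasure P] (hindep : iIndepFun X P) (hlaw : ∀ j, HasLaw (X j) Pstar P)
    {A : Set (EuclideanSpace ℝ (Fin d₁))} {B : Set (EuclideanSpace ℝ (Fin d₂))}
    (hA : IsOpen A) (hB : IsOpen B) (hAc : Convex ℝ A) (hBc : Convex ℝ B) (hBΘ : B ⊆ M.Θ₂)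
    (ht₁ : t₁ ∈ A) (ht₂ : t₂ ∈ B)
    (hsmooth : ∀ᵐ x ∂Pstar.snd, (∀ θ₁ ∈ A, ∀ θ₂ ∈ B, 0 < M.f₂ x θ₁ θ₂) ∧
      ContDiffOn ℝ 3 (M.jointLogLik₂ x) (joinSet A B))
    {G : 𝓧₂ → ℝ} (hG : Integrable G Pstar.snd)
    (hbound : ∀ᵐ x ∂Pstar.snd, ∀ θ₁ ∈ A, ∀ θ₂ ∈ B, ∀ j,
      |partialDeriv j (M.jointLogLik₂ x) (join θ₁ θ₂)| ≤ G x)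
    (hsep : M.Separated₂ P X t₁ t₂)
    (hmeas₂ : ∀ n, AEMeasurable (θhat₂ n) P)
    (hMLE : WithHighProb P
      fun n ω => M.IsTwoStageMLE n (fun j => X j ω) (θhat₁ n ω) (θhat₂ n ω))
    (hcons : ∀ δ : ℝ, 0 < δ → WithHighProb P fun n ω => ‖θhat₁ n ω - t₁‖ < δ)
    {δ : ℝ} (hδ : 0 < δ) : WithHighProb P fun n ω => ‖θhat₂ n ω - t₂‖ < δ := by
  obtain ⟨ε, hε, ρ, hρ, hsup⟩ := hsep δ hδ
  obtain ⟨r, hr, hrA⟩ := Metric.isOpen_iff.1 hA t₁ ht₁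
  let c : ℝ := Fintype.card (Fin d₁ ⊕ Fin d₂)
  have hc : 0 ≤ c := Nat.cast_nonneg _
  let g : ℝ := |∫ x, max (G x.2) 0 ∂Pstar| + 1
  have hg : 0 < g := by positivity
  -- Chosen so that the Lipschitz loss cηg stays below ε; `c + 1` avoids dividing by zero when there
  -- are no parameters.
  let η : ℝ := ε / (2 * ((c + 1) * g))
  have hη : 0 < η := by positivity
  have hG' : Integrable (fun x : 𝓧₁ × 𝓧₂ => max (G x.2) 0) Pstar :=
    (hG.comp_measurable measurable_snd).pos_part
  have hC := ((((hMLE.and (hcons ρ hρ)).and ((hcons r hr).and (hcons η hη))).and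
    (law_of_large_numbers hindep hlaw hG' one_pos)).and
    (WithHighProb.of_ae ((ae_forall_snd hlaw hsmooth).mono fun ω h (_ : ℕ) => h))).and
    (WithHighProb.of_ae ((ae_forall_snd hlaw hbound).mono fun ω h (_ : ℕ) => h))
  have hE := WithHighProb.of_tendsto_one
    (E := fun n ω => ‖θhat₂ n ω - t₂‖ < δ) hsup hC (fun n => nullMeasurableSet_lt
      ((hmeas₂ n).sub_const t₂).norm aemeasurable_const)
  refine hE ?_
  rintro n ω hsupn ⟨⟨⟨⟨⟨hM, hρn⟩, hrn, hηn⟩, hGn⟩, hsm⟩, hbd⟩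
  by_contra hδn
  rw [not_lt] at hδn
  have hmem : θhat₁ n ω ∈ A := hrA (mem_ball_iff_norm.2 hrn)
  have h1 := ((le_iSup₂ (f := fun θ₂ (_ : θ₂ ∈ {θ₂ | θ₂ ∈ M.Θ₂ ∧ δ ≤ ‖θ₂ - t₂‖}) =>
    (∑ j ∈ Finset.range n, (M.elogLik₂ (X j ω).2 (θhat₁ n ω) θ₂ - M.elogLik₂ (X j ω).2 t₁ t₂)) /
      (n : EReal)) (θhat₂ n ω) ⟨hM.2.1, hδn⟩).trans
    (le_iSup₂ (f := fun θ₁ (_ : θ₁ ∈ {θ₁ | θ₁ ∈ M.Θ₁ ∧ ‖θ₁ - t₁‖ < ρ}) =>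
      ⨆ θ₂ ∈ {θ₂ | θ₂ ∈ M.Θ₂ ∧ δ ≤ ‖θ₂ - t₂‖},
      (∑ j ∈ Finset.range n, (M.elogLik₂ (X j ω).2 θ₁ θ₂ - M.elogLik₂ (X j ω).2 t₁ t₂)) /
      (n : EReal)) (θhat₁ n ω) ⟨hM.1.1, hρn⟩)).trans hsupn
  have h2 := hM.2.2 t₂ (hBΘ ht₂)
  simp only [elogLik₂_eq_coe ((hsm _).1 _ ht₁ _ ht₂), elogLik₂_eq_coe ((hsm _).1 _ hmem _ ht₂),
    ← ereal_coe_sum] at h1 h2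
  refine not_average_ratio_le h2 ?_ h1
  have h3 (j : ℕ) : |M.logLik₂ (X j ω).2 (θhat₁ n ω) t₂ - M.logLik₂ (X j ω).2 t₁ t₂| ≤
      c * η * max (G (X j ω).2) 0 := by
    have h4 := abs_sub_le_of_partialDeriv (convex_joinSet hAc hBc)
      (fun θ hθ => differentiableAt_of_contDiffOn (isOpen_joinSet hA hB) (hsm j).2 (by norm_num) hθ)
      (fun θ hθ k => by simpa using hbd j _ hθ.1 _ hθ.2 k) (a := join t₁ t₂)
      (b := join (θhat₁ n ω) t₂) ⟨ht₁, ht₂⟩ ⟨hmem, ht₂⟩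
    refine h4.trans ?_
    rw [← join_sub_join]
    have h5 : ‖join (θhat₁ n ω - t₁) (t₂ - t₂)‖ ≤ η :=
      (norm_join_le _ _).trans (by simpa using hηn.le)
    calc _ ≤ c * max (G (X j ω).2) 0 * η := mul_le_mul_of_nonneg_left h5 (by positivity)
      _ = _ := by ring
  have h6 : |(∑ j ∈ Finset.range n,
      (M.logLik₂ (X j ω).2 (θhat₁ n ω) t₂ - M.logLik₂ (X j ω).2 t₁ t₂)) / n| ≤ c * η * g := by
    rw [abs_div, Nat.abs_cast]
    calc _ ≤ (∑ j ∈ Finset.range n, c * η * max (G (X j ω).2) 0) / n := by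
          refine div_le_div_of_nonneg_right ?_ (Nat.cast_nonneg n)
          exact (Finset.abs_sum_le_sum_abs _ _).trans (Finset.sum_le_sum fun j _ => h3 j)
      _ = c * η * ((∑ j ∈ Finset.range n, max (G (X j ω).2) 0) / n) := by
          rw [← Finset.mul_sum, mul_div_assoc]
      _ ≤ c * η * g := by
          refine mul_le_mul_of_nonneg_left ?_ (by positivity)
          have h7 := (abs_lt.1 hGn).2
          have h8 := le_abs_self (∫ x, max (G x.2) 0 ∂Pstar)
          simp only [g]; linarith
  have h9 : c * η * g < ε := by
    have : (c + 1) * η * g = ε / 2 := by simp only [η]; field_simp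
    nlinarith [mul_pos hη hg]
  linarith [(abs_le.1 h6).1]

end Consistency

end CutModel
/-! ### Moments of the score and of the Hessian -/

section Moments

variable {𝓧 : Type*} [MeasurableSpace 𝓧] {μ : Measure 𝓧}

lemma memLp_two_of_integrable_pow_four [IsFiniteMeasure μ] {G : 𝓧 → ℝ} (hG : Measurable G)
    (h4 : Integrable (fun x => G x ^ 4) μ) : MemLp G 2 μ := by
  refine (memLp_two_iff_integrable_sq hG.aestronglyMeasurable).2 ?_
  refine ((integrable_const (1 : ℝ)).add h4).mono' (hG.pow_const 2).aestronglyMeasurable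
    (.of_forall fun x => ?_)
  simp only [Real.norm_eq_abs, abs_pow, sq_abs, Pi.add_apply]
  -- The elementary bound G² ≤ 1 + G⁴, integrable because the measure is finite.
  nlinarith [sq_nonneg (G x ^ 2 - 1), sq_nonneg (G x ^ 2)]

variable {ι : Type*} [Fintype ι] [DecidableEq ι] {F : 𝓧 → EuclideanSpace ℝ ι → ℝ}
  {U : Set (EuclideanSpace ℝ ι)} {G : 𝓧 → ℝ}

lemma memLp_score [IsFiniteMeasure μ] (hU : IsOpen U) (hm : ∀ θ ∈ U, AEMeasurable (fun x => F x θ) μ)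
    (hF : ∀ᵐ x ∂μ, ContDiffOn ℝ 3 (F x) U) (hG : Measurable G)
    (h4 : Integrable (fun x => G x ^ 4) μ)
    (hb : ∀ᵐ x ∂μ, ∀ θ ∈ U, ∀ i, |partialDeriv i (F x) θ| ≤ G x) {θ : EuclideanSpace ℝ ι}
    (hθ : θ ∈ U) (i : ι) : MemLp (fun x => partialDeriv i (F x) θ) 2 μ := by
  refine (memLp_two_of_integrable_pow_four hG h4).mono' ?_ ?_
  · refine (aemeasurable_partialDeriv hU hm ?_ hθ i).aestronglyMeasurable
    filter_upwards [hF] with x hx θ hθ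
    exact differentiableAt_of_contDiffOn hU hx (by norm_num) hθ
  · filter_upwards [hb] with x hx using hx θ hθ i

lemma integrable_hessian [IsFiniteMeasure μ] (hU : IsOpen U)
    (hm : ∀ θ ∈ U, AEMeasurable (fun x => F x θ) μ)
    (hF : ∀ᵐ x ∂μ, ContDiffOn ℝ 3 (F x) U) (hG : Measurable G)
    (h4 : Integrable (fun x => G x ^ 4) μ)
    (hb : ∀ᵐ x ∂μ, ∀ θ ∈ U, ∀ j k, |partialDeriv j (partialDeriv k (F x)) θ| ≤ G x)
    {θ : EuclideanSpace ℝ ι} (hθ : θ ∈ U) (j k : ι) :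
    Integrable (fun x => partialDeriv j (partialDeriv k (F x)) θ) μ := by
  refine ((memLp_two_of_integrable_pow_four hG h4).integrable one_le_two).mono' ?_ ?_
  · refine (aemeasurable_partialDeriv hU (fun θ hθ => aemeasurable_partialDeriv hU hm ?_ hθ k)
      ?_ hθ j).aestronglyMeasurable
    · filter_upwards [hF] with x hx θ hθ
      exact differentiableAt_of_contDiffOn hU hx (by norm_num) hθ
    · filter_upwards [hF] with x hx θ hθ
      exact differentiableAt_of_contDiffOn hU
        (contDiffOn_partialDeriv (m := 2) hU hx (by norm_num) k) (by norm_num) hθ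
  · filter_upwards [hb] with x hx using hx θ hθ j k

lemma abs_score_taylor_le {f : EuclideanSpace ℝ ι → ℝ} (hU : IsOpen U) (hUc : Convex ℝ U)
    (hf : ContDiffOn ℝ 3 f U) {g : ℝ}
    (hb : ∀ θ ∈ U, ∀ j k l, |partialDeriv j (partialDeriv k (partialDeriv l f)) θ| ≤ g)
    {t θ : EuclideanSpace ℝ ι} (ht : t ∈ U) (hθ : θ ∈ U) (i : ι) :
    |partialDeriv i f θ - partialDeriv i f t -
        ∑ k, partialDeriv k (partialDeriv i f) t * (θ k - t k)| ≤
      (Fintype.card ι : ℝ) ^ 2 * max g 0 * ‖θ - t‖ ^ 2 := by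
  have h2 := contDiffOn_partialDeriv (m := 2) hU hf (by norm_num) i
  refine abs_taylor_le hUc (fun u hu => differentiableAt_of_contDiffOn hU h2 (by norm_num) hu)
    (fun u hu k => differentiableAt_of_contDiffOn hU
      (contDiffOn_partialDeriv (m := 1) hU h2 (by norm_num) k) (by norm_num) hu)
    (fun u hu j k => hb u hu j k i) ht hθ

end Moments

/-! ### The sandwich covariance -/

section Sandwich

variable {d₁ d₂ : ℕ}

/-- The inverse of the block-triangular matrix `-(J₁, 0; R_Jᵀ, J₂)`. -/
noncomputable def bread (J₁ : Matrix (Fin d₁) (Fin d₁) ℝ) (J₂ : Matrix (Fin d₂) (Fin d₂) ℝ)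
    (RJ : Matrix (Fin d₁) (Fin d₂) ℝ) : Matrix (Fin d₁ ⊕ Fin d₂) (Fin d₁ ⊕ Fin d₂) ℝ :=
  -Matrix.fromBlocks J₁⁻¹ 0 (-(J₂⁻¹ * RJ.transpose * J₁⁻¹)) J₂⁻¹

lemma bread_mul {J₁ : Matrix (Fin d₁) (Fin d₁) ℝ} {J₂ : Matrix (Fin d₂) (Fin d₂) ℝ}
    (RJ : Matrix (Fin d₁) (Fin d₂) ℝ) (h₁ : IsUnit J₁.det) (h₂ : IsUnit J₂.det) :
    bread J₁ J₂ RJ * -Matrix.fromBlocks J₁ 0 RJ.transpose J₂ = 1 := by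
  rw [bread, neg_mul_neg, Matrix.fromBlocks_multiply, ← Matrix.fromBlocks_one]
  simp [Matrix.nonsing_inv_mul _ h₁, Matrix.nonsing_inv_mul _ h₂, Matrix.mul_assoc]

/-- The second block of the influence function is J₂⁻¹(s₂ - R_Jᵀ J₁⁻¹ s₁), where s₁ and s₂ are the
two scores: estimating θ₁ corrects s₂. The cross terms of its covariance form -S₂, and its
covariance with J₁⁻¹ s₁ is S₃. The signs of the two outer factors cancel. -/
lemma bread_sandwich {I₁ J₁ : Matrix (Fin d₁) (Fin d₁) ℝ} {I₂ J₂ : Matrix (Fin d₂) (Fin d₂) ℝ}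
    (RI RJ : Matrix (Fin d₁) (Fin d₂) ℝ) (hI₁ : I₁.transpose = I₁) (hJ₁ : J₁.transpose = J₁)
    (hJ₂ : J₂.transpose = J₂) :
    bread J₁ J₂ RJ * Matrix.fromBlocks I₁ RI RI.transpose I₂ * (bread J₁ J₂ RJ).transpose =
      asympCov I₁ J₁ I₂ J₂ RI RJ := by
  have h₁ : J₁⁻¹.transpose = J₁⁻¹ := by rw [Matrix.transpose_nonsing_inv, hJ₁]
  have h₂ : J₂⁻¹.transpose = J₂⁻¹ := by rw [Matrix.transpose_nonsing_inv, hJ₂]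
  simp only [bread, asympCov, S₁, S₂, S₃, Matrix.neg_mul, Matrix.mul_neg, Matrix.transpose_neg,
    Matrix.fromBlocks_transpose, Matrix.fromBlocks_multiply, Matrix.transpose_mul,
    Matrix.transpose_sub, Matrix.transpose_transpose, h₁, h₂, hI₁, Matrix.transpose_zero,
    Matrix.zero_mul, Matrix.mul_zero, add_zero, neg_neg]
  congr 1 <;> simp only [Matrix.mul_add, Matrix.add_mul, Matrix.mul_sub, Matrix.sub_mul,
    Matrix.neg_mul, Matrix.mul_assoc] <;> abel

end Sandwich

namespace CutModel

variable {𝓧₁ 𝓧₂ : Type*} [MeasurableSpace 𝓧₁] [MeasurableSpace 𝓧₂] {d₁ d₂ : ℕ}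

/-! ### The stacked estimating equation -/

/-- The stacked score `(∂ℓ₁/∂θ₁, ∂ℓ₂/∂θ₂)`. -/
noncomputable def stackedScore (M : CutModel 𝓧₁ 𝓧₂ d₁ d₂) :
    Fin d₁ ⊕ Fin d₂ → 𝓧₁ × 𝓧₂ → EuclideanSpace ℝ (Fin d₁ ⊕ Fin d₂) → ℝ :=
  Sum.elim (fun i x θ => partialDeriv i (M.logLik₁ x.1) (fstPart θ))
    (fun i x θ => partialDeriv (Sum.inr i) (M.jointLogLik₂ x.2) θ)

/-- The Jacobian of the stacked score at `(t₁, t₂)`. -/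
noncomputable def stackedJacobian (M : CutModel 𝓧₁ 𝓧₂ d₁ d₂) (t₁ : EuclideanSpace ℝ (Fin d₁))
    (t₂ : EuclideanSpace ℝ (Fin d₂)) : Fin d₁ ⊕ Fin d₂ → Fin d₁ ⊕ Fin d₂ → 𝓧₁ × 𝓧₂ → ℝ :=
  Sum.elim
    (fun i => Sum.elim (fun k x => partialDeriv k (partialDeriv i (M.logLik₁ x.1)) t₁)
      (fun _ _ => 0))
    (fun i k x => partialDeriv k (partialDeriv (Sum.inr i) (M.jointLogLik₂ x.2)) (join t₁ t₂))

variable {M : CutModel 𝓧₁ 𝓧₂ d₁ d₂}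

/-- Each block has its own third-derivative bound; adding the two nonnegative constants gives one
remainder valid for all components. -/
lemma stackedScore_taylor {t₁ : EuclideanSpace ℝ (Fin d₁)} {t₂ : EuclideanSpace ℝ (Fin d₂)}
    {A : Set (EuclideanSpace ℝ (Fin d₁))} {B : Set (EuclideanSpace ℝ (Fin d₂))}
    (hA : IsOpen A) (hB : IsOpen B) (hAc : Convex ℝ A) (hBc : Convex ℝ B) (ht₁ : t₁ ∈ A)
    (ht₂ : t₂ ∈ B) {x : 𝓧₁ × 𝓧₂} (h₁ : ContDiffOn ℝ 3 (M.logLik₁ x.1) A)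
    (h₂ : ContDiffOn ℝ 3 (M.jointLogLik₂ x.2) (joinSet A B)) {g₁ g₂ : ℝ}
    (hb₁ : ∀ θ₁ ∈ A, ∀ j k l,
      |partialDeriv j (partialDeriv k (partialDeriv l (M.logLik₁ x.1))) θ₁| ≤ g₁)
    (hb₂ : ∀ θ₁ ∈ A, ∀ θ₂ ∈ B, ∀ j k l,
      |partialDeriv j (partialDeriv k (partialDeriv l (M.jointLogLik₂ x.2))) (join θ₁ θ₂)| ≤ g₂)
    {θ : EuclideanSpace ℝ (Fin d₁ ⊕ Fin d₂)} (hθ : θ ∈ joinSet A B) (i : Fin d₁ ⊕ Fin d₂) :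
    |M.stackedScore i x θ - M.stackedScore i x (join t₁ t₂) -
        ∑ k, M.stackedJacobian t₁ t₂ i k x * (θ k - join t₁ t₂ k)| ≤
      ((d₁ : ℝ) ^ 2 * max g₁ 0 + (d₁ + d₂ : ℝ) ^ 2 * max g₂ 0) * ‖θ - join t₁ t₂‖ ^ 2 := by
  have hpos₁ : 0 ≤ (d₁ : ℝ) ^ 2 * max g₁ 0 := by positivity
  have hpos₂ : 0 ≤ (d₁ + d₂ : ℝ) ^ 2 * max g₂ 0 := by positivity
  rcases i with i | i
  · have h := abs_score_taylor_le hA hAc h₁ hb₁ ht₁ hθ.1 i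
    have hn : ‖fstPart θ - t₁‖ ≤ ‖θ - join t₁ t₂‖ := norm_fstPart_le (θ - join t₁ t₂)
    rw [Fintype.sum_sum_type]
    simp only [stackedScore, stackedJacobian, Sum.elim_inl, Sum.elim_inr, zero_mul,
      Finset.sum_const_zero, add_zero, fstPart_join]
    refine h.trans ?_
    rw [Fintype.card_fin]
    exact mul_le_mul (by linarith) (pow_le_pow_left₀ (norm_nonneg _) hn 2) (by positivity)
      (by positivity)
  · have h := abs_score_taylor_le (isOpen_joinSet hA hB) (convex_joinSet hAc hBc) h₂
      (fun θ hθ j k l => by simpa using hb₂ _ hθ.1 _ hθ.2 j k l)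
      (⟨ht₁, ht₂⟩ : join t₁ t₂ ∈ joinSet A B) hθ (Sum.inr i)
    simp only [stackedScore, stackedJacobian, Sum.elim_inr]
    refine h.trans ?_
    rw [Fintype.card_sum, Fintype.card_fin, Fintype.card_fin, Nat.cast_add]
    exact mul_le_mul_of_nonneg_right (by linarith) (by positivity)

lemma integral_comp_fst {Pstar : Measure (𝓧₁ × 𝓧₂)} {f : 𝓧₁ → ℝ}
    (hf : AEStronglyMeasurable f Pstar.fst) : ∫ x, f x.1 ∂Pstar = ∫ x, f x ∂Pstar.fst :=
  (integral_map measurable_fst.aemeasurable hf).symm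

lemma integral_comp_snd {Pstar : Measure (𝓧₁ × 𝓧₂)} {f : 𝓧₂ → ℝ}
    (hf : AEStronglyMeasurable f Pstar.snd) : ∫ x, f x.2 ∂Pstar = ∫ x, f x ∂Pstar.snd :=
  (integral_map measurable_snd.aemeasurable hf).symm

end CutModel
end TwoStage

/-! ### Verification of the Z-estimator conditions for the stacked score -/

theorem mainTheorem6 {𝓧₁ 𝓧₂ Ω : Type*} [MeasurableSpace 𝓧₁] [MeasurableSpace 𝓧₂]
    [MeasurableSpace Ω] {d₁ d₂ : ℕ} (M : TwoStage.CutModel 𝓧₁ 𝓧₂ d₁ d₂)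
    (P : Measure Ω) [IsProbabilityMeasure P]
    (Pstar : Measure (𝓧₁ × 𝓧₂)) [IsProbabilityMeasure Pstar]
    (X : ℕ → Ω → 𝓧₁ × 𝓧₂)
    (hindep : iIndepFun X P) (hlaw : ∀ j, HasLaw (X j) Pstar P)
    (θstar₁ : EuclideanSpace ℝ (Fin d₁)) (θstar₂ : EuclideanSpace ℝ (Fin d₂))
    (hint : M.LogLikIntegrable Pstar.fst Pstar.snd)
    (htrue : M.IsPseudoTrue Pstar.fst Pstar.snd θstar₁ θstar₂)
    (hargmax : M.LocalArgmax Pstar.snd θstar₁)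
    (hsep₁ : M.Separated₁ P X θstar₁) (hsep₂ : M.Separated₂ P X θstar₁ θstar₂)
    (hreg : M.LocallyRegular Pstar.fst Pstar.snd θstar₁ θstar₂)
    (θhat₁ : ℕ → Ω → EuclideanSpace ℝ (Fin d₁)) (θhat₂ : ℕ → Ω → EuclideanSpace ℝ (Fin d₂))
    (hmeas₁ : ∀ n, AEMeasurable (θhat₁ n) P) (hmeas₂ : ∀ n, AEMeasurable (θhat₂ n) P)
    (hMLE : Tendsto
      (fun n => P {ω | ¬ M.IsTwoStageMLE n (fun j => X j ω) (θhat₁ n ω) (θhat₂ n ω)})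
      atTop (𝓝 0)) :
    (TwoStage.asympCov (M.I₁ Pstar.fst θstar₁) (M.J₁ Pstar.fst θstar₁)
      (M.I₂ Pstar.snd θstar₁ θstar₂) (M.J₂ Pstar.snd θstar₁ θstar₂)
      (M.RI Pstar θstar₁ θstar₂) (M.RJ Pstar.snd θstar₁ θstar₂)).PosSemidef ∧
    TendstoInDistribution
      (fun (n : ℕ) (ω : Ω) =>
        Real.sqrt n • TwoStage.join (θhat₁ n ω - θstar₁) (θhat₂ n ω - θstar₂))
      atTop id (fun _ => P)
      (multivariateGaussian 0
        (TwoStage.asympCov (M.I₁ Pstar.fst θstar₁) (M.J₁ Pstar.fst θstar₁)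
          (M.I₂ Pstar.snd θstar₁ θstar₂) (M.J₂ Pstar.snd θstar₁ θstar₂)
          (M.RI Pstar θstar₁ θstar₂) (M.RJ Pstar.snd θstar₁ θstar₂))) := by
  have hMLE' : TwoStage.WithHighProb P
    fun n ω => M.IsTwoStageMLE n (fun j => X j ω) (θhat₁ n ω) (θhat₂ n ω) := hMLE
  obtain ⟨r₁, hr₁, r₂, hr₂, hBΘ₁, hBΘ₂, hsm, hpd⟩ := hreg
  set A := Metric.ball θstar₁ r₁ with hAdef
  set B := Metric.ball θstar₂ r₂ with hBdef
  have hA : IsOpen A := Metric.isOpen_ball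
  have hB : IsOpen B := Metric.isOpen_ball
  have hAc : Convex ℝ A := convex_ball _ _
  have hBc : Convex ℝ B := convex_ball _ _
  have ht₁ : θstar₁ ∈ A := Metric.mem_ball_self hr₁
  have ht₂ : θstar₂ ∈ B := Metric.mem_ball_self hr₂
  have hAB : IsOpen (TwoStage.joinSet A B) := TwoStage.isOpen_joinSet hA hB
  have ht : TwoStage.join θstar₁ θstar₂ ∈ TwoStage.joinSet A B := ⟨ht₁, ht₂⟩
  have hm₁ : ∀ θ ∈ A, AEMeasurable (fun x => M.logLik₁ x θ) Pstar.fst := fun θ hθ =>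
    (M.measurable_f₁ θ (hBΘ₁ hθ)).coe_nnreal_real.log.aemeasurable
  have hm₂ : ∀ θ ∈ TwoStage.joinSet A B,
      AEMeasurable (fun x => M.jointLogLik₂ x θ) Pstar.snd := fun θ hθ =>
    (M.measurable_f₂ _ (hBΘ₁ hθ.1) _ (hBΘ₂ hθ.2)).coe_nnreal_real.log.aemeasurable
  have hC₁ := hsm.contDiff₁
  have hC₂ : ∀ᵐ x ∂Pstar.snd, (∀ θ₁ ∈ A, ∀ θ₂ ∈ B, 0 < M.f₂ x θ₁ θ₂) ∧
    ContDiffOn ℝ 3 (M.jointLogLik₂ x) (TwoStage.joinSet A B) := hsm.contDiff₂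
  have hC₁' := hC₁.mono fun x hx => hx.2
  have hC₂' := hC₂.mono fun x hx => hx.2
  obtain ⟨G₁, hG₁, hG₁4, hb₁⟩ := hsm.bound₁
  obtain ⟨G₂, hG₂, hG₂4, hb₂⟩ := hsm.bound₂
  obtain ⟨G₃, hG₃, hG₃i, hb₃⟩ := hsm.bound₃
  obtain ⟨G₄, hG₄, hG₄4, hb₄⟩ := hsm.bound₄
  obtain ⟨G₅, hG₅, hG₅4, hb₅⟩ := hsm.bound₅
  obtain ⟨G₆, hG₆, hG₆i, hb₆⟩ := hsm.bound₆
  have hb₄' : ∀ᵐ x ∂Pstar.snd, ∀ θ ∈ TwoStage.joinSet A B, ∀ j,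
      |TwoStage.partialDeriv j (M.jointLogLik₂ x) θ| ≤ G₄ x := by
    filter_upwards [hb₄] with x hx θ hθ j
    simpa using hx _ hθ.1 _ hθ.2 j
  have hb₅' : ∀ᵐ x ∂Pstar.snd, ∀ θ ∈ TwoStage.joinSet A B, ∀ j k,
      |TwoStage.partialDeriv j (TwoStage.partialDeriv k (M.jointLogLik₂ x)) θ| ≤ G₅ x := by
    filter_upwards [hb₅] with x hx θ hθ j k
    simpa using hx _ hθ.1 _ hθ.2 j k
  have hs₁ := TwoStage.memLp_score hA hm₁ hC₁' hG₁ hG₁4 hb₁ ht₁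
  have hs₂ := TwoStage.memLp_score hAB hm₂ hC₂' hG₄ hG₄4 hb₄' ht
  have hh₁ := TwoStage.integrable_hessian hA hm₁ hC₁' hG₂ hG₂4 hb₂ ht₁
  have hh₂ := TwoStage.integrable_hessian hAB hm₂ hC₂' hG₅ hG₅4 hb₅' ht
  have hcons₁ (δ : ℝ) (hδ : 0 < δ) := TwoStage.CutModel.consistent₁ hlaw htrue.argmax₁.1
    (hint.pos₁ _ htrue.argmax₁.1) hsep₁ hmeas₁ hMLE' hδ
  have hcons₂ (δ : ℝ) (hδ : 0 < δ) := TwoStage.CutModel.consistent₂ hindep hlaw hA hB hAc hBc hBΘ₂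
    ht₁ ht₂ hC₂ ((TwoStage.memLp_two_of_integrable_pow_four hG₄ hG₄4).integrable one_le_two) hb₄
    hsep₂ hmeas₂ hMLE' hcons₁ hδ
  have hz₁ (i : Fin d₁) :
      ∫ x, TwoStage.partialDeriv i (M.logLik₁ x) θstar₁ ∂Pstar.fst = 0 := by
    refine TwoStage.integral_partialDeriv_eq_zero hA (fun θ hθ => hint.integrable₁ θ (hBΘ₁ hθ)) ?_
      ht₁ ((TwoStage.memLp_two_of_integrable_pow_four hG₁ hG₁4).integrable one_le_two)
      (hb₁.mono fun x hx θ hθ => hx θ hθ i) ?_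
    · filter_upwards [hC₁'] with x hx θ hθ
      exact TwoStage.differentiableAt_of_contDiffOn hA hx (by norm_num) hθ
    · have hcont : Continuous fun s : ℝ => θstar₁ + s • EuclideanSpace.single i (1 : ℝ) := by
        fun_prop
      filter_upwards [(hA.preimage hcont).mem_nhds (by simpa using ht₁ : (0 : ℝ) ∈ _)] with s hs
      rcases eq_or_ne (θstar₁ + s • EuclideanSpace.single i (1 : ℝ)) θstar₁ with h | h
      · simp [h]
      · simpa using (htrue.argmax₁.2 _ (hBΘ₁ hs) h).le
  -- Only the θ₂-components are centred: the pseudo-true θ₂ maximizes with θ₁ held fixed, so ∂ℓ₂/∂θ₁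
  -- may have nonzero mean. The stacked score omits it.
  have hz₂ (i : Fin d₂) : ∫ x, TwoStage.partialDeriv (Sum.inr i) (M.jointLogLik₂ x)
      (TwoStage.join θstar₁ θstar₂) ∂Pstar.snd = 0 := by
    refine TwoStage.integral_partialDeriv_eq_zero hAB
      (fun θ hθ => hint.integrable₂ _ (hBΘ₁ hθ.1) _ (hBΘ₂ hθ.2)) ?_
      ht ((TwoStage.memLp_two_of_integrable_pow_four hG₄ hG₄4).integrable one_le_two)
      (hb₄'.mono fun x hx θ hθ => hx θ hθ _) ?_
    · filter_upwards [hC₂'] with x hx θ hθ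
      exact TwoStage.differentiableAt_of_contDiffOn hAB hx (by norm_num) hθ
    · have hcont : Continuous fun s : ℝ => θstar₂ + s • EuclideanSpace.single i (1 : ℝ) := by
        fun_prop
      filter_upwards [(hB.preimage hcont).mem_nhds (by simpa using ht₂ : (0 : ℝ) ∈ _)] with s hs
      simp only [TwoStage.fstPart_add_single_inr,
        TwoStage.sndPart_add_single_inr, TwoStage.fstPart_join, TwoStage.sndPart_join, zero_smul,
        add_zero]
      rcases eq_or_ne (θstar₂ + s • EuclideanSpace.single i (1 : ℝ)) θstar₂ with h | h
      · simp [h]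
      · exact (htrue.argmax₂.2 _ (hBΘ₂ hs) h).le
  have hI₁ := (hpd.posDef_I₁ _ ht₁).isHermitian
  have hJ₁ := hpd.posDef_J₁ _ ht₁
  have hJ₂ := hpd.posDef_J₂ _ ht₁ _ ht₂
  have hJ₁s : (M.J₁ Pstar.fst θstar₁).transpose = M.J₁ Pstar.fst θstar₁ := by
    simpa [Matrix.IsHermitian] using hJ₁.isHermitian
  have hJ₂s : (M.J₂ Pstar.snd θstar₁ θstar₂).transpose = M.J₂ Pstar.snd θstar₁ θstar₂ := by
    simpa [Matrix.IsHermitian] using hJ₂.isHermitian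
  have hI₁s : (M.I₁ Pstar.fst θstar₁).transpose = M.I₁ Pstar.fst θstar₁ := by
    simpa [Matrix.IsHermitian] using hI₁
  have hJac : (Matrix.of fun i k =>
      ∫ x, M.stackedJacobian θstar₁ θstar₂ i k x ∂Pstar) =
      -Matrix.fromBlocks (M.J₁ Pstar.fst θstar₁) 0 (M.RJ Pstar.snd θstar₁ θstar₂).transpose
        (M.J₂ Pstar.snd θstar₁ θstar₂) := by
    -- The Jacobian entry (i, k) differentiates in the order opposite to entry (i, k) of `J₁` and
    -- `J₂`. Their symmetry, known from positive definiteness, replaces an interchange of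
    -- derivatives.
    rw [← hJ₁s, ← hJ₂s]
    ext i k
    rcases i with i | i <;> rcases k with k | k
    · simpa [TwoStage.CutModel.stackedJacobian, TwoStage.CutModel.J₁] using
        TwoStage.CutModel.integral_comp_fst (hh₁ k i).aestronglyMeasurable
    · simp [TwoStage.CutModel.stackedJacobian]
    · simpa [TwoStage.CutModel.stackedJacobian, TwoStage.CutModel.RJ] using
        TwoStage.CutModel.integral_comp_snd (hh₂ (Sum.inl k) (Sum.inr i)).aestronglyMeasurable
    · simpa [TwoStage.CutModel.stackedJacobian, TwoStage.CutModel.J₂] using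
        TwoStage.CutModel.integral_comp_snd (hh₂ (Sum.inr k) (Sum.inr i)).aestronglyMeasurable
  have hV : TwoStage.secondMoment Pstar
      (fun i x => M.stackedScore i x (TwoStage.join θstar₁ θstar₂)) =
      Matrix.fromBlocks (M.I₁ Pstar.fst θstar₁) (M.RI Pstar θstar₁ θstar₂)
        (M.RI Pstar θstar₁ θstar₂).transpose (M.I₂ Pstar.snd θstar₁ θstar₂) := by
    ext i k
    rcases i with i | i <;> rcases k with k | k
    · simpa [TwoStage.secondMoment, TwoStage.CutModel.stackedScore, TwoStage.CutModel.I₁] using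
        TwoStage.CutModel.integral_comp_fst ((hs₁ i).integrable_mul (hs₁ k)).aestronglyMeasurable
    · simp [TwoStage.secondMoment, TwoStage.CutModel.stackedScore, TwoStage.CutModel.RI]
    · simp [TwoStage.secondMoment, TwoStage.CutModel.stackedScore, TwoStage.CutModel.RI, mul_comm]
    · simpa [TwoStage.secondMoment, TwoStage.CutModel.stackedScore, TwoStage.CutModel.I₂] using
        TwoStage.CutModel.integral_comp_snd
          ((hs₂ (Sum.inr i)).integrable_mul (hs₂ (Sum.inr k))).aestronglyMeasurable
  let G : 𝓧₁ × 𝓧₂ → ℝ := fun x =>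
    (d₁ : ℝ) ^ 2 * max (G₃ x.1) 0 + (d₁ + d₂ : ℝ) ^ 2 * max (G₆ x.2) 0
  have hG : Integrable G Pstar :=
    ((hG₃i.comp_measurable measurable_fst).pos_part.const_mul _).add
      ((hG₆i.comp_measurable measurable_snd).pos_part.const_mul _)
  -- The Z-estimator theorem needs a Euclidean ball in the joint space; one of the smaller radius
  -- fits in the product of the two balls because each block has norm at most the joint norm.
  have hball : Metric.ball (TwoStage.join θstar₁ θstar₂) (min r₁ r₂) ⊆ TwoStage.joinSet A B := by
    intro θ hθ
    rw [mem_ball_iff_norm, lt_min_iff] at hθ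
    exact ⟨mem_ball_iff_norm.2 ((TwoStage.norm_fstPart_le
        (θ - TwoStage.join θstar₁ θstar₂)).trans_lt hθ.1),
      mem_ball_iff_norm.2 ((TwoStage.norm_sndPart_le
        (θ - TwoStage.join θstar₁ θstar₂)).trans_lt hθ.2)⟩
  have main := TwoStage.tendstoInDistribution_zEstimator hindep hlaw (lt_min hr₁ hr₂)
    (t := TwoStage.join θstar₁ θstar₂) (Ψ := M.stackedScore)
    (D := M.stackedJacobian θstar₁ θstar₂) (G := G)
    (B := TwoStage.bread (M.J₁ Pstar.fst θstar₁) (M.J₂ Pstar.snd θstar₁ θstar₂)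
      (M.RJ Pstar.snd θstar₁ θstar₂))
    (θhat := fun n ω => TwoStage.join (θhat₁ n ω) (θhat₂ n ω)) ?_ ?_ ?_ hG ?_ ?_ ?_ ?_ ?_
  · rw [hV, TwoStage.bread_sandwich _ _ hI₁s hJ₁s hJ₂s] at main
    simpa only [TwoStage.join_sub_join] using main
  · rintro (i | i)
    · exact (hs₁ i).comp_of_map measurable_fst.aemeasurable
    · exact (hs₂ (Sum.inr i)).comp_of_map measurable_snd.aemeasurable
  · rintro (i | i)
    · exact (TwoStage.CutModel.integral_comp_fst (hs₁ i).aestronglyMeasurable).trans (hz₁ i)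
    · exact (TwoStage.CutModel.integral_comp_snd
        (hs₂ (Sum.inr i)).aestronglyMeasurable).trans (hz₂ i)
  · rintro (i | i) k
    · rcases k with k | k
      · exact (hh₁ k i).comp_measurable measurable_fst
      · exact integrable_zero _ _ _
    · exact (hh₂ k (Sum.inr i)).comp_measurable measurable_snd
  · filter_upwards [ae_of_ae_map measurable_fst.aemeasurable hC₁',
      ae_of_ae_map measurable_snd.aemeasurable hC₂',
      ae_of_ae_map measurable_fst.aemeasurable hb₃,
      ae_of_ae_map measurable_snd.aemeasurable hb₆] with x h1 h2 h3 h4 θ hθ i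
    exact TwoStage.CutModel.stackedScore_taylor hA hB hAc hBc ht₁ ht₂ h1 h2 h3 h4 (hball hθ) i
  · rw [hJac]
    exact TwoStage.bread_mul _ ((Matrix.isUnit_iff_isUnit_det _).1 hJ₁.isUnit)
      ((Matrix.isUnit_iff_isUnit_det _).1 hJ₂.isUnit)
  · exact fun n => TwoStage.continuous_join.measurable.comp_aemeasurable
      ((hmeas₁ n).prodMk (hmeas₂ n))
  · intro δ hδ
    refine ((hcons₁ (δ / 2) (half_pos hδ)).and (hcons₂ (δ / 2) (half_pos hδ))).mono ?_
    rintro n ω ⟨h1, h2⟩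
    rw [← TwoStage.join_sub_join]
    exact (TwoStage.norm_join_le _ _).trans_lt (by linarith)
  · refine (((hMLE'.and ((hcons₁ r₁ hr₁).and (hcons₂ r₂ hr₂))).and
      (TwoStage.WithHighProb.of_ae
        ((TwoStage.CutModel.ae_forall_fst hlaw hC₁).mono fun ω h (_ : ℕ) => h))).and
      (TwoStage.WithHighProb.of_ae
        ((TwoStage.CutModel.ae_forall_snd hlaw hC₂).mono fun ω h (_ : ℕ) => h))).mono ?_
    rintro n ω ⟨⟨⟨hM, h1, h2⟩, h3⟩, h4⟩ (i | i)
    · exact hM.sum_score₁ hA hBΘ₁ (mem_ball_iff_norm.2 h1) h3 i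
    · exact hM.sum_score₂ hA hB hBΘ₂ (mem_ball_iff_norm.2 h1) (mem_ball_iff_norm.2 h2) h4 i
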